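/- Let $P$ be an irreducible, aperiodic, row-stochastic matrix on a finite state space $V=\{1,\dots,N\}$ with stationary distribution $\pi$. For $t\ge 1$ let $\mathcal S^t$ be the set of feasible sequences, that is, of $s=(s_1,\dots,s_t)\in V^t$ with $\pi_{s_1}\prod_{k=1}^{t-1}P_{s_ks_{k+1}}>0$, and let $C_t=|\mathcal S^t|$. To each $t\ge1$ and $s\in\mathcal S^t$ attach a random vector $Z_{s}=(Z_{s,1},\dots,Z_{s,t})$ on a probability space $(\Omega,\mathcal F,\mathbb P)$, such that all the coordinates $Z_{s,k}$ (over all $t\ge 1$, $s\in\mathcal S^t$, $1\le k\le t$) are independent standard Gaussian variables. For $s\in\mathcal S^t$ put, with the circular convention $s_{t+1}=s_1$, $$[\Theta_t(s)]_{ij}=\tfrac1t\,\bigl|\{1\le k\le t:\ s_k=i,\ s_{k+1}=j\}\bigr|,\qquad \mathcal Z^\omega_{t,i}(s)=\tfrac1t\sum_{k:\,s_k=i}Z_{s,k}(\omega)$$ (an empty sum being $0$), and let $Q_t^\omega(B)=\frac1{C_t}\bigl|\{s\in\mathcal S^t:(\Theta_t(s),\mathcal Z_t^\omega(s))\in B\}\bigr|$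 for Borel sets $B\subseteq\mathbb R^{N\times N}\times\mathbb R^N$. Let $\rho_0$ be the spectral radius of the zero-one matrix with the same zero entries as $P$. Let $\Delta$ be the set of $\theta\in\mathbb R^{N\times N}$ with $\theta_{ij}\ge0$, $\sum_{i,j}\theta_{ij}=1$, $\sum_j\theta_{ij}=\sum_j\theta_{ji}$ for all $i$, and $\theta_{ij}=0$ whenever $P_{ij}=0$. With $\overline\theta_i=\sum_j\theta_{ij}$ and $0\log0=0$ put $H(\theta)=-\sum_{i,j}\theta_{ij}\log(\theta_{ij}/\overline\theta_i)$; put $J_\theta(\xi)=\sum_{i:\overline\theta_i>0}\frac{\xi_i^2}{2\overline\theta_i}$ if $\xi_i=0$ for every $i$ with $\overline\theta_i=0$, and $J_\theta(\xi)=+\infty$ otherwise. Define $$I(\theta,\xi)=\begin{cases}\log\rho_0-H(\theta)+J_\theta(\xi)&\text{if }\theta\in\Delta\text{ and }H(\theta)\ge J_\theta(\xi),\\ +\infty&\text{otherwise.}\end{cases}$$ Theorem. $I$ is a rate function (lower semicontinuous with values in $[0,+\infty]$), and the sequence $Q_t^\omega$ satisfies the large deviations principle with rate function $I$ with probability one: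 for $\mathbb P$-almost every $\omega$, for every Borel set $G\subseteq\mathbb R^{N\times N}\times\mathbb R^N$, $$\limsup_{t\to\infty}\tfrac1t\log Q_t^\omega(G)\le-\inf_{x\in\overline G}I(x)\qquad\text{and}\qquad\liminf_{t\to\infty}\tfrac1t\log Q_t^\omega(G)\ge-\inf_{x\in G^{\mathrm o}}I(x),$$ with $\log 0=-\infty$ and $\inf\emptyset=+\infty$. -/

import Mathlib

open MeasureTheory ProbabilityTheory Filter

noncomputable section

namespace GaussMarkov

/-! ### Large deviations -/

/-- A rate function: a lower semicontinuous function with values in `[0, ∞]`. -/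
def IsRateFunction {X : Type*} [TopologicalSpace X] (I : X → EReal) : Prop :=
  LowerSemicontinuous I ∧ ∀ x, 0 ≤ I x

/-- The large deviations upper bound for the set `G`:
`limsup (1/t) log μ_t(G) ≤ - inf_{closure G} I`, with `log 0 = -∞` and `inf ∅ = +∞`. -/
def LDPUpperBound {X : Type*} [TopologicalSpace X] [MeasurableSpace X]
    (μ : ℕ → Measure X) (I : X → EReal) (G : Set X) : Prop :=
  limsup (fun t : ℕ => ((1 / (t : ℝ) : ℝ) : EReal) * ENNReal.log (μ t G)) atTop
    ≤ -(⨅ x ∈ closure G, I x)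

/-- The large deviations lower bound for the set `G`:
`liminf (1/t) log μ_t(G) ≥ - inf_{interior G} I`. -/
def LDPLowerBound {X : Type*} [TopologicalSpace X] [MeasurableSpace X]
    (μ : ℕ → Measure X) (I : X → EReal) (G : Set X) : Prop :=
  -(⨅ x ∈ interior G, I x)
    ≤ liminf (fun t : ℕ => ((1 / (t : ℝ) : ℝ) : EReal) * ENNReal.log (μ t G)) atTop

/-- The two large deviations bounds hold for every measurable set. -/
def SatisfiesLDP {X : Type*} [TopologicalSpace X] [MeasurableSpace X]
    (μ : ℕ → Measure X) (I : X → EReal) : Prop :=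
  ∀ G : Set X, MeasurableSet G → LDPUpperBound μ I G ∧ LDPLowerBound μ I G

variable {V : Type*} [Fintype V] [DecidableEq V]

/-! ### The Markov chain -/

/-- `π` is a stationary distribution of the transition matrix `P`. -/
structure IsStationary (π : V → ℝ) (P : Matrix V V ℝ) : Prop where
  nonneg : ∀ i, 0 ≤ π i
  sum_eq_one : ∑ i, π i = 1
  stationary : ∀ j, ∑ i, π i * P i j = π j

/-- Aperiodicity: at every state `i` the greatest common divisor of the return times
`{n ≥ 1 : (P ^ n) i i > 0}` is one. -/
def IsAperiodic (P : Matrix V V ℝ) : Prop :=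
  ∀ i : V, ∀ d : ℕ, (∀ n : ℕ, 0 < n → 0 < (P ^ n) i i → d ∣ n) → d = 1

/-- The probability `π (s 1) * ∏_{k < t} P (s k) (s (k + 1))` of the sequence `s` of length `t`. -/
def pathProb (π : V → ℝ) (P : Matrix V V ℝ) : (t : ℕ) → (Fin t → V) → ℝ
  | 0, _ => 1
  | n + 1, s => π (s 0) * ∏ k : Fin n, P (s k.castSucc) (s k.succ)

open Classical in
/-- The finite set of feasible sequences of length `t`: those of positive probability. -/
def feasible (π : V → ℝ) (P : Matrix V V ℝ) (t : ℕ) : Finset (Fin t → V) :=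
  Finset.univ.filter fun s => 0 < pathProb π P t s

/-- The zero-one sparsity matrix of `P`, with complex entries. -/
def sparsity (P : Matrix V V ℝ) : Matrix V V ℂ :=
  open Classical in Matrix.of fun i j => if P i j = 0 then 0 else 1

/-- The spectral radius of the sparsity matrix of `P`. -/
def rho (P : Matrix V V ℝ) : ℝ := (spectralRadius ℂ (sparsity P)).toReal

/-! ### Gauss–Markov types -/

/-- The transition counts of the sequence `s`, read circularly: the last state is followed by
the first one. -/
def transCount {t : ℕ} (s : Fin t → V) (i j : V) : ℕ :=
  (Finset.univ.filter fun k : Fin t => s k = i ∧ s (finRotate t k) = j).card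

/-- The Markov type of `s`. -/
def markovType {t : ℕ} (s : Fin t → V) : V → V → ℝ :=
  fun i j => (transCount s i j : ℝ) / t

/-- For each node `i`, the sum of the signal values `z k` over the visiting times `k` of `i`,
divided by `t` (this is `0` if `i` is not visited). -/
def signalType {t : ℕ} (s : Fin t → V) (z : Fin t → ℝ) : V → ℝ :=
  fun i => (∑ k : Fin t with s k = i, z k) / t

/-- Index set of the noise variables: a length `t`, a feasible sequence of length `t`,
and a coordinate `k` of the vector attached to this sequence. -/
abbrev NoiseIndex (π : V → ℝ) (P : Matrix V V ℝ) : Type _ :=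
  Σ t : ℕ, feasible π P t × Fin t

/-- The empirical measure of the Gauss–Markov type over all feasible sequences of length `t`,
for a realization `z` of the noise variables. -/
def empMeasure (π : V → ℝ) (P : Matrix V V ℝ) (z : NoiseIndex π P → ℝ) (t : ℕ) :
    Measure ((V → V → ℝ) × (V → ℝ)) :=
  ((feasible π P t).card : ENNReal)⁻¹ •
    ∑ s : feasible π P t,
      Measure.dirac (markovType s.1, signalType s.1 fun k => z ⟨t, s, k⟩)

/-! ### The rate function -/

/-- Row sums. -/
def rowSum (θ : V → V → ℝ) (i : V) : ℝ := ∑ j, θ i j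

/-- The polytope `Δ`; the edges of the graph are the pairs `(i, j)` with `P i j ≠ 0`. -/
def typePolytope (P : Matrix V V ℝ) : Set (V → V → ℝ) :=
  {θ | ∑ i, ∑ j, θ i j = 1 ∧ (∀ i, ∑ j, θ i j = ∑ j, θ j i) ∧
    (∀ i j, 0 ≤ θ i j) ∧ ∀ i j, P i j = 0 → θ i j = 0}

/-- The entropy `H`, with `0 log 0 = 0`. -/
def entropy (θ : V → V → ℝ) : ℝ :=
  - ∑ i, ∑ j, θ i j * Real.log (θ i j / rowSum θ i)

open Classical in
/-- The function `J_θ`. -/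
def gaussCost (θ : V → V → ℝ) (ξ : V → ℝ) : EReal :=
  if ∀ i, rowSum θ i = 0 → ξ i = 0 then
    ((∑ i with 0 < rowSum θ i, 1 / rowSum θ i * (ξ i ^ 2 / 2) : ℝ) : EReal)
  else ⊤

open Classical in
/-- The rate function `I`. -/
def rate (P : Matrix V V ℝ) (x : (V → V → ℝ) × (V → ℝ)) : EReal :=
  if x.1 ∈ typePolytope P ∧ gaussCost x.1 x.2 ≤ (entropy x.1 : EReal) then
    ((Real.log (rho P) - entropy x.1 : ℝ) : EReal) + gaussCost x.1 x.2
  else ⊤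

end GaussMarkov

end

namespace GaussMarkov

/-! ### A local criterion for the large deviations principle -/

/-! The number of hits factors into entropy and noise. About `exp (t H(θ))` feasible sequences have
Markov type near `θ`, and each carries its own Gaussian vector, which brings its signal type near
`ξ` with probability about `exp (-t J_θ(ξ))`. The expected number `hits` of sequences with type near
`(θ, ξ)` is therefore about `exp (t (H - J))`.

If `H < J`, Markov's inequality and Borel–Cantelli force this integer below one, hence to zero,
almost surely for all large `t`; this explains the value `+∞` of the rate. If `H > J`, independence
over the sequences bounds the variance by the mean, so Chebyshev's failure probability decays
exponentially and the count stays above half its mean. Dividing by the number of feasible sequences,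
which grows like `exp (t log ρ₀)` by Gelfand's formula, gives the rate.

Sequences are counted by change of measure. A positive stochastic matrix gives every sequence of
cross entropy below `b` a probability above `exp (-t b)`, which bounds their number
(`card_crossEntropy_lt_le`); conversely the chain with pair distribution `θ` concentrates on types
near `θ`, by strict Gibbs and compactness (`exp_le_card_markovType_mem`). The Gaussian cost is
handled by duality: `dualCost l` is a normalized log-likelihood ratio, which yields the Chernoff
bound `measureReal_dualCost_ge_le` and the tilting bound `exp_mul_le_measureReal_type_mem`.

Boundary points (`H = J`, or `θ` vanishing on some edge) are approximated by shrinking `ξ` and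
mixing `θ` with the stationary pair law; when `H = J = 0` a single hit is enough
(`ae_eventually_one_le_hits`). Finally `ae_satisfiesLDP_of_local` passes from local estimates to all
Borel sets outside one null set. -/

lemma eventually_const_mul_exp_le (c : ℝ) {a b : ℝ} (hab : a < b) :
    ∀ᶠ t : ℕ in atTop, c * Real.exp (t * a) ≤ Real.exp (t * b) := by
  have h : Tendsto (fun t : ℕ => Real.exp ((t : ℝ) * (b - a))) atTop atTop :=
    Real.tendsto_exp_atTop.comp
      (tendsto_natCast_atTop_atTop.atTop_mul_const (by linarith))
  filter_upwards [h.eventually_ge_atTop c] with t ht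
  calc c * Real.exp (t * a) ≤ Real.exp (t * (b - a)) * Real.exp (t * a) := by gcongr
    _ = Real.exp (t * b) := by rw [← Real.exp_add]; ring_nf

lemma scaled_log_le {t : ℕ} (ht : 0 < t) {x : ENNReal} {a : ℝ}
    (h : x ≤ ENNReal.ofReal (Real.exp (t * a))) :
    ((1 / (t : ℝ) : ℝ) : EReal) * ENNReal.log x ≤ (a : EReal) := by
  have h1 : ENNReal.log x ≤ ((t * a : ℝ) : EReal) := by
    refine (ENNReal.log_monotone h).trans ?_
    rw [ENNReal.log_ofReal_of_pos (Real.exp_pos _), Real.log_exp]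
  have h0 : (0 : EReal) ≤ ((1 / (t : ℝ) : ℝ) : EReal) := by
    exact_mod_cast (by positivity : (0 : ℝ) ≤ 1 / t)
  refine (mul_le_mul_of_nonneg_left h1 h0).trans (le_of_eq ?_)
  rw [← EReal.coe_mul]
  congr 1
  field_simp

lemma le_scaled_log {t : ℕ} (ht : 0 < t) {x : ENNReal} {a : ℝ}
    (h : ENNReal.ofReal (Real.exp (t * a)) ≤ x) :
    (a : EReal) ≤ ((1 / (t : ℝ) : ℝ) : EReal) * ENNReal.log x := by
  have h1 : ((t * a : ℝ) : EReal) ≤ ENNReal.log x := by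
    refine le_trans ?_ (ENNReal.log_monotone h)
    rw [ENNReal.log_ofReal_of_pos (Real.exp_pos _), Real.log_exp]
  have h0 : (0 : EReal) ≤ ((1 / (t : ℝ) : ℝ) : EReal) := by
    exact_mod_cast (by positivity : (0 : ℝ) ≤ 1 / t)
  refine le_trans (le_of_eq ?_) (mul_le_mul_of_nonneg_left h1 h0)
  rw [← EReal.coe_mul]
  congr 1
  field_simp

/-- Since the measures eventually live on one compact set, finitely many of the local neighbourhoods
cover the part of `closure G` that matters, and a union bound suffices. -/
theorem satisfiesLDP_of_local {X : Type*} [TopologicalSpace X] [MeasurableSpace X]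
    {μ : ℕ → Measure X} {I : X → EReal} {K : Set X} (hK : IsCompact K)
    (htight : ∀ᶠ t in atTop, μ t Kᶜ = 0)
    (hupper : ∀ x, ∀ α : ℝ, (α : EReal) < I x → ∃ U, IsOpen U ∧ x ∈ U ∧
      ∀ᶠ t : ℕ in atTop, μ t U ≤ ENNReal.ofReal (Real.exp (t * (-α))))
    (hlower : ∀ x, ∀ α : ℝ, I x < (α : EReal) → ∀ U, IsOpen U → x ∈ U →
      ∀ᶠ t : ℕ in atTop, ENNReal.ofReal (Real.exp (t * (-α))) ≤ μ t U) :
    SatisfiesLDP μ I := by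
  intro G _
  constructor
  · unfold LDPUpperBound
    rw [EReal.le_neg]
    refine le_of_forall_lt fun c hc => ?_
    obtain ⟨α, hcα, hα⟩ := EReal.lt_iff_exists_real_btwn.1 hc
    -- The local bounds are used at level `β`; the gap `β - α` absorbs the number of covering sets.
    obtain ⟨β, hαβ, hβ⟩ := EReal.lt_iff_exists_real_btwn.1 hα
    refine hcα.trans_le ?_
    rw [EReal.le_neg]
    have hloc : ∀ x ∈ closure G, (β : EReal) < I x := fun x hx =>
      hβ.trans_le (iInf₂_le x hx)
    choose! U hUo hxU hU using fun x (hx : x ∈ closure G) => hupper x β (hloc x hx)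
    have hcomp : IsCompact (closure G ∩ K) := hK.inter_left isClosed_closure
    obtain ⟨T, hT, hcover⟩ := hcomp.elim_nhds_subcover U
      (fun x hx => (hUo x hx.1).mem_nhds (hxU x hx.1))
    have hev : ∀ᶠ t : ℕ in atTop, ∀ x ∈ T,
        μ t (U x) ≤ ENNReal.ofReal (Real.exp (t * (-β))) :=
      (Filter.eventually_all_finset T).2 fun x hx => hU x (hT x hx).1
    refine limsup_le_of_le (by isBoundedDefault) ?_
    rw [← EReal.coe_neg]
    filter_upwards [hev, htight, eventually_gt_atTop 0,
      eventually_const_mul_exp_le (T.card : ℝ) (neg_lt_neg (EReal.coe_lt_coe_iff.1 hαβ))]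
      with t ht hKt ht0 hexp
    refine scaled_log_le ht0 ?_
    have hsub : G ⊆ (⋃ x ∈ T, U x) ∪ Kᶜ := fun y hy => by
      by_cases hyK : y ∈ K
      · exact Or.inl (hcover ⟨subset_closure hy, hyK⟩)
      · exact Or.inr hyK
    calc μ t G ≤ μ t (⋃ x ∈ T, U x) + μ t Kᶜ :=
          (measure_mono hsub).trans (measure_union_le _ _)
      _ ≤ ∑ x ∈ T, μ t (U x) := by
          rw [hKt, add_zero]; exact measure_biUnion_finset_le _ _
      _ ≤ ∑ x ∈ T, ENNReal.ofReal (Real.exp (t * (-β))) := Finset.sum_le_sum ht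
      _ = ENNReal.ofReal (T.card * Real.exp (t * (-β))) := by
          rw [Finset.sum_const, nsmul_eq_mul, ENNReal.ofReal_mul (by positivity),
            ENNReal.ofReal_natCast]
      _ ≤ _ := ENNReal.ofReal_le_ofReal hexp
  · unfold LDPLowerBound
    rw [EReal.neg_le]
    refine le_iInf₂ fun x hx => ?_
    rw [EReal.neg_le]
    refine le_of_forall_lt fun c hc => ?_
    obtain ⟨α, hcα, hα⟩ := EReal.lt_iff_exists_real_btwn.1 hc
    refine hcα.trans_le ?_
    have hIx : I x < ((-α : ℝ) : EReal) := by
      rw [EReal.coe_neg]; exact EReal.lt_neg_comm.1 hα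
    refine le_liminf_of_le (by isBoundedDefault) ?_
    filter_upwards [hlower x (-α) hIx (interior G) isOpen_interior hx, eventually_gt_atTop 0]
      with t ht ht0
    rw [neg_neg] at ht
    exact le_scaled_log ht0 (ht.trans (measure_mono interior_subset))

/-- The exceptional null sets depend on the point, the level and the neighbourhood. Restricting to a
countable basis and rational levels leaves countably many of them. -/
theorem ae_satisfiesLDP_of_local {X : Type*} [TopologicalSpace X] [SecondCountableTopology X]
    [MeasurableSpace X] {Ω : Type*} [MeasurableSpace Ω] {ν : Measure Ω}
    {μ : Ω → ℕ → Measure X} {I : X → EReal} {K : Set X} (hK : IsCompact K)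
    (htight : ∀ᵐ ω ∂ν, ∀ᶠ t in atTop, μ ω t Kᶜ = 0)
    (hupper : ∀ x, ∀ α : ℝ, (α : EReal) < I x → ∃ U, IsOpen U ∧ x ∈ U ∧
      ∀ᵐ ω ∂ν, ∀ᶠ t : ℕ in atTop, μ ω t U ≤ ENNReal.ofReal (Real.exp (t * (-α))))
    (hlower : ∀ x, ∀ α : ℝ, I x < (α : EReal) → ∀ U, IsOpen U → x ∈ U →
      ∀ᵐ ω ∂ν, ∀ᶠ t : ℕ in atTop, ENNReal.ofReal (Real.exp (t * (-α))) ≤ μ ω t U) :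
    ∀ᵐ ω ∂ν, SatisfiesLDP (μ ω) I := by
  have hB := TopologicalSpace.isBasis_countableBasis X
  have hBc := TopologicalSpace.countable_countableBasis X
  -- Stated as an implication, so that it can be asserted for every pair `(U, q)` at once: pairs
  -- whose bound is not almost sure hold vacuously.
  have hup : ∀ᵐ ω ∂ν, ∀ U ∈ TopologicalSpace.countableBasis X, ∀ q : ℚ,
      (∀ᵐ ω' ∂ν, ∀ᶠ t : ℕ in atTop,
        μ ω' t U ≤ ENNReal.ofReal (Real.exp (t * (-(q : ℝ))))) →
      ∀ᶠ t : ℕ in atTop, μ ω t U ≤ ENNReal.ofReal (Real.exp (t * (-(q : ℝ)))) := by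
    refine (ae_ball_iff hBc).2 fun U _ => ae_all_iff.2 fun q => ?_
    by_cases h : ∀ᵐ ω' ∂ν, ∀ᶠ t : ℕ in atTop,
        μ ω' t U ≤ ENNReal.ofReal (Real.exp (t * (-(q : ℝ))))
    · filter_upwards [h] with ω hω _ using hω
    · exact Eventually.of_forall fun ω hω => absurd hω h
  have hlo : ∀ᵐ ω ∂ν, ∀ U ∈ TopologicalSpace.countableBasis X, ∀ q : ℚ,
      (∃ x ∈ U, I x < ((q : ℝ) : EReal)) →
      ∀ᶠ t : ℕ in atTop, ENNReal.ofReal (Real.exp (t * (-(q : ℝ)))) ≤ μ ω t U := by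
    refine (ae_ball_iff hBc).2 fun U hU => ae_all_iff.2 fun q => ?_
    by_cases h : ∃ x ∈ U, I x < ((q : ℝ) : EReal)
    · obtain ⟨x, hxU, hx⟩ := h
      filter_upwards [hlower x q hx U (hB.isOpen hU) hxU] with ω hω _ using hω
    · exact Eventually.of_forall fun ω hω => absurd hω h
  filter_upwards [htight, hup, hlo] with ω h1 h2 h3
  refine satisfiesLDP_of_local hK h1 (fun x α hα => ?_) (fun x α hα U hU hxU => ?_)
  · obtain ⟨β, hαβ, hβ⟩ := EReal.lt_iff_exists_real_btwn.1 hα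
    obtain ⟨q, hαq, hqβ⟩ := exists_rat_btwn (EReal.coe_lt_coe_iff.1 hαβ)
    obtain ⟨U, hUo, hxU, hU⟩ := hupper x q ((EReal.coe_lt_coe_iff.2 hqβ).trans hβ)
    obtain ⟨W, hW, hxW, hWU⟩ := hB.exists_subset_of_mem_open hxU hUo
    refine ⟨W, hB.isOpen hW, hxW, ?_⟩
    filter_upwards [h2 W hW q (hU.mono fun ω' h => h.mono fun t ht =>
      (measure_mono hWU).trans ht)] with t ht
    refine ht.trans (ENNReal.ofReal_le_ofReal (Real.exp_le_exp.2 ?_))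
    exact mul_le_mul_of_nonneg_left (by linarith) (Nat.cast_nonneg t)
  · obtain ⟨β, hβ, hβα⟩ := EReal.lt_iff_exists_real_btwn.1 hα
    obtain ⟨q, hβq, hqα⟩ := exists_rat_btwn (EReal.coe_lt_coe_iff.1 hβα)
    obtain ⟨W, hW, hxW, hWU⟩ := hB.exists_subset_of_mem_open hxU hU
    filter_upwards [h3 W hW q ⟨x, hxW, hβ.trans (EReal.coe_lt_coe_iff.2 hβq)⟩] with t ht
    refine le_trans ?_ (ht.trans (measure_mono hWU))
    refine ENNReal.ofReal_le_ofReal (Real.exp_le_exp.2 ?_)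
    exact mul_le_mul_of_nonneg_left (by linarith) (Nat.cast_nonneg t)

variable {V : Type*} [Fintype V] [DecidableEq V]

/-! ### Paths and circular types -/

omit [DecidableEq V] [Fintype V] in
lemma forall_of_backward_closed {P : Matrix V V ℝ} (hirr : P.IsIrreducible) {S : V → Prop}
    (h : ∀ i j, 0 < P i j → S j → S i) {j : V} (hj : S j) (i : V) : S i := by
  let := Matrix.toQuiver P
  obtain ⟨p, -⟩ := hirr.connected i j
  induction p with
  | nil => exact hj
  | cons p e ih => exact ih (h _ _ e.down hj)

omit [DecidableEq V] [Fintype V] in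
lemma forall_of_forward_closed {P : Matrix V V ℝ} (hirr : P.IsIrreducible) {S : V → Prop}
    (h : ∀ i j, 0 < P i j → S i → S j) {i : V} (hi : S i) (j : V) : S j := by
  let := Matrix.toQuiver P
  obtain ⟨p, -⟩ := hirr.connected i j
  induction p with
  | nil => exact hi
  | cons p e ih => exact h _ _ e.down ih

omit [DecidableEq V] in
lemma IsStationary.pos {P : Matrix V V ℝ} (hirr : P.IsIrreducible) {π : V → ℝ}
    (hπ : IsStationary π P) (i : V) : 0 < π i := by
  obtain ⟨i₀, hi₀⟩ : ∃ i₀, 0 < π i₀ := by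
    by_contra! h
    have := Finset.sum_nonpos fun i (_ : i ∈ Finset.univ) => h i
    linarith [hπ.sum_eq_one]
  refine forall_of_forward_closed hirr (S := fun i => 0 < π i) (fun i j hij hi => ?_) hi₀ i
  rw [← hπ.stationary j]
  exact Finset.sum_pos' (fun k _ => mul_nonneg (hπ.nonneg k) (hirr.nonneg k j))
    ⟨i, Finset.mem_univ i, mul_pos hi hij⟩

/-- The arbitrary initial weight makes the induction close: deleting a first state `a` leaves a path
with initial weight the row `M a`. -/
lemma sum_pathProb (f : V → ℝ) (M : Matrix V V ℝ) (n : ℕ) :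
    ∑ s, pathProb f M (n + 1) s = ∑ i, f i * ∑ j, (M ^ n) i j := by
  induction n generalizing f with
  | zero =>
    rw [← (Equiv.funUnique (Fin 1) V).symm.sum_comp]
    refine Finset.sum_congr rfl fun i _ => ?_
    simp [pathProb, Matrix.one_apply, uniqueElim]
  | succ n ih =>
    rw [← (Fin.consEquiv (fun _ : Fin (n + 2) => V)).sum_comp, Fintype.sum_prod_type]
    refine Finset.sum_congr rfl fun a _ => ?_
    have h : ∀ s : Fin (n + 1) → V,
        pathProb f M (n + 1 + 1) (Fin.consEquiv (fun _ : Fin (n + 2) => V) (a, s))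
          = f a * pathProb (M a) M (n + 1) s := by
      intro s
      simp only [pathProb, Fin.consEquiv, Equiv.coe_fn_mk, Fin.cons_zero, Fin.prod_univ_succ,
        Fin.castSucc_zero, Fin.cons_succ, ← Fin.succ_castSucc]
    simp_rw [h]
    rw [← Finset.mul_sum, ih, pow_succ']
    simp_rw [Matrix.mul_apply]
    rw [Finset.sum_comm (s := Finset.univ (α := V))]
    simp_rw [Finset.mul_sum]

lemma sum_pathProb_of_mem_rowStochastic (f : V → ℝ) {Q : Matrix V V ℝ}
    (hQ : Q ∈ Matrix.rowStochastic ℝ V) (n : ℕ) :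
    ∑ s, pathProb f Q (n + 1) s = ∑ i, f i := by
  rw [sum_pathProb]
  refine Finset.sum_congr rfl fun i _ => ?_
  rw [Matrix.sum_row_of_mem_rowStochastic (pow_mem hQ n), mul_one]

lemma sum_transCount {t : ℕ} (s : Fin t → V) (g : V → V → ℝ) :
    ∑ i, ∑ j, (transCount s i j : ℝ) * g i j = ∑ k, g (s k) (s (finRotate t k)) := by
  have h : ∀ i j, (transCount s i j : ℝ) * g i j
      = ∑ k, if s k = i then if s (finRotate t k) = j then g i j else 0 else 0 := by
    intro i j
    simp only [← ite_and]
    rw [transCount, Finset.card_filter, Nat.cast_sum, Finset.sum_mul]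
    exact Finset.sum_congr rfl fun k _ => by split_ifs <;> simp
  simp_rw [h]
  rw [Finset.sum_congr rfl fun i _ => Finset.sum_comm, Finset.sum_comm]
  refine Finset.sum_congr rfl fun k _ => ?_
  simp [Finset.sum_ite_eq]

lemma sum_markovType {t : ℕ} (ht : 0 < t) (s : Fin t → V) (g : V → V → ℝ) :
    t * ∑ i, ∑ j, markovType s i j * g i j = ∑ k, g (s k) (s (finRotate t k)) := by
  rw [← sum_transCount]
  simp_rw [Finset.mul_sum, markovType]
  refine Finset.sum_congr rfl fun i _ => Finset.sum_congr rfl fun j _ => ?_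
  have : (t : ℝ) ≠ 0 := by positivity
  field_simp

omit [Fintype V] in
lemma markovType_nonneg {t : ℕ} (s : Fin t → V) (i j : V) : 0 ≤ markovType s i j := by
  unfold markovType; positivity

lemma sum_markovType_eq_one {t : ℕ} (ht : 0 < t) (s : Fin t → V) :
    ∑ i, ∑ j, markovType s i j = 1 := by
  have h := sum_markovType ht s fun _ _ => 1
  have : (t : ℝ) ≠ 0 := by positivity
  simp only [mul_one, Finset.sum_const, Finset.card_univ, Fintype.card_fin, nsmul_eq_mul] at h
  exact mul_left_cancel₀ this (by linarith)

lemma markovType_balanced {t : ℕ} (ht : 0 < t) (s : Fin t → V) (i : V) :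
    ∑ j, markovType s i j = ∑ j, markovType s j i := by
  have : (t : ℝ) ≠ 0 := by positivity
  refine mul_left_cancel₀ this ?_
  have h1 := sum_markovType ht s fun a _ => if a = i then 1 else 0
  have h2 := sum_markovType ht s fun _ a => if a = i then 1 else 0
  rw [Equiv.sum_comp (finRotate t) (fun k => if s k = i then (1 : ℝ) else 0), ← h1] at h2
  simp only [mul_ite, mul_one, mul_zero, Finset.sum_ite_eq', Finset.mem_univ, if_true] at h2
  rw [h2]
  simp

lemma markovType_le_one {t : ℕ} (ht : 0 < t) (s : Fin t → V) (i j : V) :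
    markovType s i j ≤ 1 := by
  rw [← sum_markovType_eq_one ht s]
  exact (Finset.single_le_sum (f := fun j => markovType s i j)
      (fun j _ => markovType_nonneg s i j) (Finset.mem_univ j)).trans
    (Finset.single_le_sum (f := fun i => ∑ j, markovType s i j)
      (fun i _ => Finset.sum_nonneg fun j _ => markovType_nonneg s i j) (Finset.mem_univ i))

omit [Fintype V] [DecidableEq V] in
lemma sum_finRotate {n : ℕ} (s : Fin (n + 1) → V) (g : V → V → ℝ) :
    ∑ k, g (s k) (s (finRotate (n + 1) k))
      = ∑ k : Fin n, g (s k.castSucc) (s k.succ) + g (s (Fin.last n)) (s 0) := by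
  rw [Fin.sum_univ_castSucc]
  simp [Fin.coeSucc_eq_succ]

/-- The circular type counts one transition more than the path, from the last state to the first,
and its logarithm is taken off again. That transition may have weight zero: `Real.log 0 = 0` then
appears in both places. -/
lemma pathProb_eq_exp (f : V → ℝ) (M : Matrix V V ℝ) {n : ℕ} (s : Fin (n + 1) → V)
    (h : ∀ k : Fin n, 0 < M (s k.castSucc) (s k.succ)) :
    pathProb f M (n + 1) s = f (s 0) *
      Real.exp (((n + 1 : ℕ) : ℝ) * ∑ i, ∑ j, markovType s i j * Real.log (M i j)
        - Real.log (M (s (Fin.last n)) (s 0))) := by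
  rw [sum_markovType n.succ_pos s fun i j => Real.log (M i j),
    sum_finRotate s fun i j => Real.log (M i j), add_sub_cancel_right, Real.exp_sum, pathProb]
  congr 1
  exact Finset.prod_congr rfl fun k _ => (Real.exp_log (h k)).symm

omit [DecidableEq V] in
lemma mem_feasible_succ {P : Matrix V V ℝ} (hP : ∀ i j, 0 ≤ P i j) {π : V → ℝ}
    (hπ : ∀ i, 0 < π i) {n : ℕ} {s : Fin (n + 1) → V} :
    s ∈ feasible π P (n + 1) ↔ ∀ k : Fin n, 0 < P (s k.castSucc) (s k.succ) := by
  rw [feasible, Finset.mem_filter, and_iff_right (Finset.mem_univ s), pathProb,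
    mul_pos_iff_of_pos_left (hπ _)]
  refine ⟨fun h k => (hP _ _).lt_of_ne fun h0 => ?_, fun h => Finset.prod_pos fun k _ => h k⟩
  exact h.ne' (Finset.prod_eq_zero (Finset.mem_univ k) h0.symm)

/-- Only the closing transition of a feasible sequence can use a forbidden edge, and it occurs once.
-/
lemma markovType_le_of_eq_zero {P : Matrix V V ℝ} (hP : ∀ i j, 0 ≤ P i j) {π : V → ℝ}
    (hπ : ∀ i, 0 < π i) {t : ℕ} {s : Fin t → V} (hs : s ∈ feasible π P t)
    {i j : V} (hij : P i j = 0) : markovType s i j ≤ 1 / t := by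
  unfold markovType
  gcongr
  norm_cast
  rcases t with - | n
  · simp [transCount]
  rw [mem_feasible_succ hP hπ] at hs
  refine (Finset.card_le_card (t := {Fin.last n}) fun k hk => ?_).trans (by simp)
  rw [Finset.mem_singleton]
  rw [Finset.mem_filter] at hk
  induction k using Fin.lastCases with
  | last => rfl
  | cast k =>
  obtain ⟨-, hk⟩ := hk
  have := hs k
  rw [finRotate_apply, Fin.coeSucc_eq_succ] at hk
  rw [hk.1, hk.2, hij] at this
  exact absurd this (lt_irrefl _)

/-! ### Growth of the number of feasible sequences -/

/-- The zero-one sparsity matrix of `P`, with real entries. -/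
noncomputable def support (P : Matrix V V ℝ) : Matrix V V ℝ :=
  open Classical in Matrix.of fun i j => if P i j = 0 then 0 else 1

omit [Fintype V] [DecidableEq V] in
lemma support_nonneg (P : Matrix V V ℝ) (i j : V) : 0 ≤ support P i j := by
  simp only [support, Matrix.of_apply]; split_ifs <;> simp

lemma pow_support_nonneg (P : Matrix V V ℝ) (n : ℕ) (i j : V) : 0 ≤ (support P ^ n) i j := by
  induction n generalizing i j with
  | zero => rw [pow_zero, Matrix.one_apply]; split_ifs <;> simp
  | succ n ih =>
    rw [pow_succ, Matrix.mul_apply]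
    exact Finset.sum_nonneg fun k _ => mul_nonneg (ih i k) (support_nonneg P k j)

lemma sparsity_pow (P : Matrix V V ℝ) (n : ℕ) :
    sparsity P ^ n = (support P ^ n).map (algebraMap ℝ ℂ) := by
  rw [Matrix.map_pow]
  congr 1
  ext i j
  simp only [sparsity, support, Matrix.map_apply, Matrix.of_apply]
  split_ifs <;> simp

/-- The support matrix dominates `P` entrywise, so its rows sum to at least one. This keeps the
norms and counts below away from zero, so that their logarithms are meaningful. -/
lemma one_le_sum_pow_support {P : Matrix V V ℝ} (hP : P ∈ Matrix.rowStochastic ℝ V) (n : ℕ)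
    (i : V) : 1 ≤ ∑ j, (support P ^ n) i j := by
  induction n generalizing i with
  | zero => simp [Matrix.one_apply]
  | succ n ih =>
    have h1 : 1 ≤ ∑ k, support P i k := by
      rw [← Matrix.sum_row_of_mem_rowStochastic hP i]
      refine Finset.sum_le_sum fun k _ => ?_
      simp only [support, Matrix.of_apply]
      split_ifs with h
      · exact h.le
      · exact Matrix.le_one_of_mem_rowStochastic hP
    calc (1 : ℝ) ≤ ∑ k, support P i k := h1
      _ ≤ ∑ k, support P i k * ∑ j, (support P ^ n) k j :=
          Finset.sum_le_sum fun k _ => le_mul_of_one_le_right (support_nonneg P i k) (ih k)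
      _ = ∑ j, (support P ^ (n + 1)) i j := by
          simp_rw [pow_succ', Matrix.mul_apply, Finset.mul_sum]
          exact Finset.sum_comm

lemma card_feasible_succ {P : Matrix V V ℝ} (hP : ∀ i j, 0 ≤ P i j) {π : V → ℝ}
    (hπ : ∀ i, 0 < π i) (n : ℕ) :
    ((feasible π P (n + 1)).card : ℝ) = ∑ i, ∑ j, (support P ^ n) i j := by
  classical
  have h := sum_pathProb (fun _ => 1) (support P) n
  simp only [one_mul] at h
  rw [← h, Finset.card_eq_sum_ones, Nat.cast_sum]
  rw [← Finset.sum_subset (Finset.subset_univ (feasible π P (n + 1)))]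
  · refine Finset.sum_congr rfl fun s hs => ?_
    rw [mem_feasible_succ hP hπ] at hs
    simp only [pathProb, support, Matrix.of_apply, one_mul, Nat.cast_one]
    exact (Finset.prod_eq_one fun k _ => if_neg (hs k).ne').symm
  · intro s _ hs
    rw [mem_feasible_succ hP hπ] at hs
    push Not at hs
    obtain ⟨k, hk⟩ := hs
    simp only [pathProb, support, Matrix.of_apply, one_mul]
    exact Finset.prod_eq_zero (Finset.mem_univ k) (if_pos (hk.antisymm (hP _ _)))

/-! ### Gelfand's formula for the sparsity matrix -/

section Gelfand

attribute [local instance] Matrix.linftyOpNormedRing Matrix.linftyOpNormedAlgebra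

lemma norm_sparsity_pow_le (P : Matrix V V ℝ) (n : ℕ) :
    ‖sparsity P ^ n‖ ≤ ∑ i, ∑ j, (support P ^ n) i j := by
  have h0 : 0 ≤ ∑ i, ∑ j, (support P ^ n) i j :=
    Finset.sum_nonneg fun i _ => Finset.sum_nonneg fun j _ => pow_support_nonneg P n i j
  rw [Matrix.linfty_opNorm_def, ← NNReal.coe_mk _ h0, NNReal.coe_le_coe]
  refine Finset.sup_le fun i _ => ?_
  rw [← NNReal.coe_le_coe]
  push_cast
  refine le_trans (le_of_eq ?_) (Finset.single_le_sum
    (f := fun i => ∑ j, (support P ^ n) i j)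
    (fun i _ => Finset.sum_nonneg fun j _ => pow_support_nonneg P n i j) (Finset.mem_univ i))
  refine Finset.sum_congr rfl fun j _ => ?_
  rw [sparsity_pow]
  simp [abs_of_nonneg (pow_support_nonneg P n i j)]

lemma sum_pow_support_le (P : Matrix V V ℝ) (n : ℕ) (i : V) :
    ∑ j, (support P ^ n) i j ≤ ‖sparsity P ^ n‖ := by
  rw [Matrix.linfty_opNorm_def]
  refine le_trans (le_of_eq ?_) (NNReal.coe_le_coe.2
    (Finset.le_sup (f := fun i => ∑ j, ‖(sparsity P ^ n) i j‖₊) (Finset.mem_univ i)))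
  push_cast
  refine Finset.sum_congr rfl fun j _ => ?_
  rw [sparsity_pow]
  simp [abs_of_nonneg (pow_support_nonneg P n i j)]

/-- Gelfand's formula in logarithmic form. The `ℓ^∞` operator norm is the largest row sum, hence
within a factor `card V` of the number of feasible sequences. -/
lemma tendsto_log_norm_sparsity_pow [Nonempty V] {P : Matrix V V ℝ}
    (hP : P ∈ Matrix.rowStochastic ℝ V) :
    Tendsto (fun n : ℕ => Real.log ‖sparsity P ^ n‖ / n) atTop (nhds (Real.log (rho P))) := by
  have hone : ∀ n, 1 ≤ ‖sparsity P ^ n‖ := fun n =>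
    (one_le_sum_pow_support hP n (Classical.arbitrary V)).trans (sum_pow_support_le P n _)
  have hG := spectrum.pow_norm_pow_one_div_tendsto_nhds_spectralRadius (sparsity P)
  have htop : spectralRadius ℂ (sparsity P) ≠ ⊤ := by
    refine ne_top_of_le_ne_top ?_ (spectrum.spectralRadius_le_nnnorm (sparsity P))
    exact ENNReal.coe_ne_top
  have hR : Tendsto (fun n : ℕ => ‖sparsity P ^ n‖ ^ (1 / n : ℝ)) atTop (nhds (rho P)) := by
    refine ((ENNReal.tendsto_toReal htop).comp hG).congr fun n => ?_
    exact ENNReal.toReal_ofReal (by positivity)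
  have hρ : 1 ≤ rho P := ge_of_tendsto' hR fun n =>
    Real.one_le_rpow (hone n) (by positivity)
  refine ((Real.continuousAt_log (by linarith)).tendsto.comp hR).congr fun n => ?_
  rw [Function.comp_apply, Real.log_rpow (by linarith [hone n])]
  ring

lemma exp_le_card_feasible {P : Matrix V V ℝ} (hP : P ∈ Matrix.rowStochastic ℝ V) [Nonempty V]
    {π : V → ℝ} (hπ : ∀ i, 0 < π i) {a : ℝ} (ha : a < Real.log (rho P)) :
    ∀ᶠ t : ℕ in atTop, Real.exp (t * a) ≤ (feasible π P t).card := by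
  obtain ⟨b, hab, hb⟩ := exists_between ha
  rw [← map_add_atTop_eq_nat 1]
  refine eventually_map.2 ?_
  -- A sequence of length `n + 1` has only `n` transitions; the factor `exp a` pays for the shift.
  filter_upwards [(tendsto_log_norm_sparsity_pow hP).eventually_const_lt hb,
    eventually_const_mul_exp_le (Real.exp a) hab, eventually_gt_atTop 0] with n hn hexp hn0
  rw [card_feasible_succ (fun i j => Matrix.nonneg_of_mem_rowStochastic hP) hπ]
  have hpos : 0 < ‖sparsity P ^ n‖ := lt_of_lt_of_le zero_lt_one
    ((one_le_sum_pow_support hP n (Classical.arbitrary V)).trans (sum_pow_support_le P n _))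
  rw [lt_div_iff₀ (by positivity), Real.lt_log_iff_exp_lt hpos, mul_comm] at hn
  refine le_trans ?_ (hn.le.trans (norm_sparsity_pow_le P n))
  refine le_trans (le_of_eq ?_) hexp
  rw [← Real.exp_add]
  push_cast
  ring_nf

lemma card_feasible_le_exp {P : Matrix V V ℝ} (hP : P ∈ Matrix.rowStochastic ℝ V) [Nonempty V]
    {π : V → ℝ} (hπ : ∀ i, 0 < π i) {a : ℝ} (ha : Real.log (rho P) < a) :
    ∀ᶠ t : ℕ in atTop, (feasible π P t).card ≤ Real.exp (t * a) := by
  obtain ⟨b, hb, hba⟩ := exists_between ha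
  rw [← map_add_atTop_eq_nat 1]
  refine eventually_map.2 ?_
  filter_upwards [(tendsto_log_norm_sparsity_pow hP).eventually_lt_const hb,
    eventually_const_mul_exp_le (Fintype.card V * Real.exp (-a)) hba, eventually_gt_atTop 0]
    with n hn hexp hn0
  rw [card_feasible_succ (fun i j => Matrix.nonneg_of_mem_rowStochastic hP) hπ]
  have hpos : 0 < ‖sparsity P ^ n‖ := lt_of_lt_of_le zero_lt_one
    ((one_le_sum_pow_support hP n (Classical.arbitrary V)).trans (sum_pow_support_le P n _))
  rw [div_lt_iff₀ (by positivity), Real.log_lt_iff_lt_exp hpos, mul_comm] at hn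
  calc ∑ i, ∑ j, (support P ^ n) i j ≤ ∑ i : V, Real.exp (n * b) :=
        Finset.sum_le_sum fun i _ => (sum_pow_support_le P n i).trans hn.le
    _ = Real.exp a * (Fintype.card V * Real.exp (-a) * Real.exp (n * b)) := by
        rw [Finset.sum_const, Finset.card_univ, nsmul_eq_mul, Real.exp_neg]
        field_simp
    _ ≤ Real.exp a * Real.exp (n * a) := by gcongr
    _ = Real.exp (((n + 1 : ℕ) : ℝ) * a) := by
        rw [← Real.exp_add]
        push_cast
        ring_nf

end Gelfand

lemma card_feasible_pos {P : Matrix V V ℝ} (hP : P ∈ Matrix.rowStochastic ℝ V) [Nonempty V]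
    {π : V → ℝ} (hπ : ∀ i, 0 < π i) {t : ℕ} (ht : 0 < t) : 0 < (feasible π P t).card := by
  obtain ⟨n, rfl⟩ := Nat.exists_eq_succ_of_ne_zero ht.ne'
  rw [← Nat.cast_pos (α := ℝ), Nat.succ_eq_add_one,
    card_feasible_succ (fun i j => Matrix.nonneg_of_mem_rowStochastic hP) hπ]
  exact Finset.sum_pos (fun i _ => zero_lt_one.trans_le (one_le_sum_pow_support hP n i))
    Finset.univ_nonempty

/-! ### Entropy and the polytope of types -/

omit [DecidableEq V] in
lemma rowSum_nonneg {θ : V → V → ℝ} (hθ : ∀ i j, 0 ≤ θ i j) (i : V) : 0 ≤ rowSum θ i :=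
  Finset.sum_nonneg fun j _ => hθ i j

omit [DecidableEq V] in
lemma le_rowSum {θ : V → V → ℝ} (hθ : ∀ i j, 0 ≤ θ i j) (i j : V) : θ i j ≤ rowSum θ i :=
  Finset.single_le_sum (fun j _ => hθ i j) (Finset.mem_univ j)

omit [DecidableEq V] in
lemma continuous_rowSum (i : V) : Continuous fun θ : V → V → ℝ => rowSum θ i := by
  unfold rowSum; fun_prop

omit [DecidableEq V] in
lemma continuous_pairing (g : V → V → ℝ) :
    Continuous fun θ : V → V → ℝ => ∑ i, ∑ j, θ i j * g i j := by fun_prop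

omit [DecidableEq V] in
-- The quotient form of the entropy is awkward where a row sum vanishes; in this form continuity up
-- to the boundary is visible.
lemma entropy_eq_sum_negMulLog {θ : V → V → ℝ} (hθ : ∀ i j, 0 ≤ θ i j) :
    entropy θ = ∑ i, ∑ j, Real.negMulLog (θ i j) - ∑ i, Real.negMulLog (rowSum θ i) := by
  rw [← Finset.sum_sub_distrib, entropy, ← Finset.sum_neg_distrib]
  refine Finset.sum_congr rfl fun i _ => ?_
  have h : Real.negMulLog (rowSum θ i) = ∑ j, -(θ i j * Real.log (rowSum θ i)) := by
    rw [Real.negMulLog, Finset.sum_neg_distrib, ← Finset.sum_mul, ← rowSum, neg_mul]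
  rw [h, ← Finset.sum_sub_distrib, ← Finset.sum_neg_distrib]
  refine Finset.sum_congr rfl fun j _ => ?_
  rcases (hθ i j).eq_or_lt with h0 | h0
  · simp [← h0]
  · rw [Real.log_div h0.ne' (h0.trans_le (le_rowSum hθ i j)).ne', Real.negMulLog]
    ring

omit [DecidableEq V] in
lemma continuousOn_entropy :
    ContinuousOn (entropy : (V → V → ℝ) → ℝ) {θ | ∀ i j, 0 ≤ θ i j} := by
  refine ContinuousOn.congr (f := fun θ : V → V → ℝ =>
    ∑ i, ∑ j, Real.negMulLog (θ i j) - ∑ i, Real.negMulLog (rowSum θ i)) ?_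
    fun θ hθ => entropy_eq_sum_negMulLog hθ
  refine Continuous.continuousOn ?_
  have := fun i => Real.continuous_negMulLog.comp (continuous_rowSum (V := V) i)
  simp only [Function.comp_def] at this
  fun_prop

omit [DecidableEq V] in
lemma isClosed_typePolytope (P : Matrix V V ℝ) : IsClosed (typePolytope P) := by
  have h : typePolytope P = {θ | ∑ i, ∑ j, θ i j = 1} ∩
      ((⋂ i, {θ | ∑ j, θ i j = ∑ j, θ j i}) ∩
        ((⋂ i, ⋂ j, {θ | 0 ≤ θ i j}) ∩ ⋂ i, ⋂ j, ⋂ _ : P i j = 0, {θ | θ i j = 0})) := by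
    ext θ; simp [typePolytope]
  rw [h]
  refine (isClosed_eq (by fun_prop) (by fun_prop)).inter
    ((isClosed_iInter fun i => isClosed_eq (by fun_prop) (by fun_prop)).inter
    ((isClosed_iInter fun i => isClosed_iInter fun j => isClosed_le (by fun_prop) (by fun_prop)).inter
    (isClosed_iInter fun i => isClosed_iInter fun j => isClosed_iInter fun _ =>
      isClosed_eq (by fun_prop) (by fun_prop))))

/-- The entropy is approximated by cross entropies against positive stochastic matrices. -/
lemma exists_crossEntropy_lt [Nonempty V] {θ : V → V → ℝ} (hθ : ∀ i j, 0 ≤ θ i j)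
    (hsum : ∑ i, ∑ j, θ i j = 1) {b : ℝ} (hb : entropy θ < b) :
    ∃ Q ∈ Matrix.rowStochastic ℝ V, (∀ i j, 0 < Q i j) ∧
      -∑ i, ∑ j, θ i j * Real.log (Q i j) < b := by
  obtain ⟨c, hc, hcb⟩ := exists_between hb
  -- `Q` mixes the conditional law of `θ`, with weight `r`, and the uniform law, which makes it
  -- positive. As `Q ≥ r R`, this raises the cross entropy by at most `-log r = c - entropy θ`.
  set r := Real.exp (entropy θ - c) with hr
  have hr0 : 0 < r := Real.exp_pos _
  have hr1 : r < 1 := Real.exp_lt_one_iff.2 (by linarith)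
  set N := (Fintype.card V : ℝ) with hN
  have hN0 : 0 < N := by simp [hN, Fintype.card_pos]
  classical
  let R : V → V → ℝ := fun i j => if rowSum θ i = 0 then 1 / N else θ i j / rowSum θ i
  have hR0 : ∀ i j, 0 ≤ R i j := fun i j => by
    simp only [R]; split_ifs
    · positivity
    · exact div_nonneg (hθ i j) (rowSum_nonneg hθ i)
  have hRsum : ∀ i, ∑ j, R i j = 1 := fun i => by
    simp only [R]; split_ifs with h
    · simp [hN]
    · rw [← Finset.sum_div, ← rowSum, div_self h]
  let Q : Matrix V V ℝ := Matrix.of fun i j => r * R i j + (1 - r) / N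
  have hQ0 : ∀ i j, 0 < Q i j := fun i j => by
    have h1 : 0 < (1 - r) / N := div_pos (by linarith) hN0
    have h2 := mul_nonneg hr0.le (hR0 i j)
    simp only [Q, Matrix.of_apply]; linarith
  refine ⟨Q, ?_, hQ0, ?_⟩
  · rw [Matrix.mem_rowStochastic_iff_sum]
    refine ⟨fun i j => (hQ0 i j).le, fun i => ?_⟩
    simp only [Q, Matrix.of_apply]
    rw [Finset.sum_add_distrib, ← Finset.mul_sum, hRsum, Finset.sum_const, Finset.card_univ,
      nsmul_eq_mul, ← hN]
    field_simp
    ring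
  · refine lt_of_le_of_lt ?_ hcb
    have h : ∀ i j, θ i j * Real.log (θ i j / rowSum θ i) + θ i j * (entropy θ - c)
        ≤ θ i j * Real.log (Q i j) := by
      intro i j
      rcases (hθ i j).eq_or_lt with h0 | h0
      · simp [← h0]
      · have hpos := h0.trans_le (le_rowSum hθ i j)
        rw [← mul_add]
        refine mul_le_mul_of_nonneg_left ?_ h0.le
        rw [← Real.log_exp (entropy θ - c), ← Real.log_mul (div_pos h0 hpos).ne' hr0.ne']
        refine Real.log_le_log (mul_pos (div_pos h0 hpos) hr0) ?_
        have h1 : 0 < (1 - r) / N := div_pos (by linarith) hN0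
        simp only [Q, R, Matrix.of_apply, if_neg hpos.ne']
        linarith
    have h2 := Finset.sum_le_sum fun i (_ : i ∈ Finset.univ) =>
      Finset.sum_le_sum fun j (_ : j ∈ Finset.univ) => h i j
    simp only [Finset.sum_add_distrib, ← Finset.sum_mul] at h2
    rw [hsum] at h2
    have h3 : entropy θ = - ∑ i, ∑ j, θ i j * Real.log (θ i j / rowSum θ i) := rfl
    linarith

/-- A type in the polytope is positive on all edges. -/
def HasFullSupport (P : Matrix V V ℝ) (θ : V → V → ℝ) : Prop :=
  θ ∈ typePolytope P ∧ ∀ i j, 0 < P i j → 0 < θ i j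

omit [DecidableEq V] in
-- Perron argument: with `c` the minimum of `p / q`, the vector `p - c q` is nonnegative, invariant
-- and vanishes somewhere; its zeros propagate backwards along edges, so it is zero, and
-- normalization gives `c = 1`.
lemma stationary_unique {P : Matrix V V ℝ} (hirr : P.IsIrreducible)
    {Q : V → V → ℝ} (hQ : ∀ i j, 0 ≤ Q i j) (hQP : ∀ i j, 0 < P i j → 0 < Q i j)
    {p q : V → ℝ} (hq : ∀ i, 0 < q i) (hp1 : ∑ i, p i = 1) (hq1 : ∑ i, q i = 1)
    (hps : ∀ j, ∑ i, p i * Q i j = p j) (hqs : ∀ j, ∑ i, q i * Q i j = q j) : p = q := by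
  have hne : Nonempty V := by
    by_contra h
    rw [not_nonempty_iff] at h
    simp at hp1
  obtain ⟨i₀, hi₀⟩ := Finite.exists_min fun i => p i / q i
  set c := p i₀ / q i₀ with hc
  have hv : ∀ i, 0 ≤ p i - c * q i := fun i => by
    have := hi₀ i
    rw [le_div_iff₀ (hq i)] at this
    linarith
  have hz : ∀ i, p i - c * q i = 0 := by
    refine forall_of_backward_closed hirr (S := fun i => p i - c * q i = 0)
      (j := i₀) (fun i j hij hj => ?_) ?_
    · have h1 : ∑ k, (p k - c * q k) * Q k j = 0 := by
        simp_rw [sub_mul, mul_assoc]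
        rw [Finset.sum_sub_distrib, ← Finset.mul_sum, hps, hqs]
        exact hj
      rw [Finset.sum_eq_zero_iff_of_nonneg fun k _ => mul_nonneg (hv k) (hQ k j)] at h1
      exact (mul_eq_zero.1 (h1 i (Finset.mem_univ i))).resolve_right (hQP i j hij).ne'
    · have := (hq i₀).ne'
      rw [hc]
      field_simp
      ring
  have hc1 : c = 1 := by
    have h1 : ∑ i, (p i - c * q i) = 0 := Finset.sum_eq_zero fun i _ => hz i
    rw [Finset.sum_sub_distrib, ← Finset.mul_sum, hp1, hq1] at h1
    linarith
  funext i
  have := hz i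
  rw [hc1] at this
  linarith

lemma sub_lt_mul_log_div {x y : ℝ} (hx : 0 ≤ x) (hy : 0 < y) (hxy : x ≠ y) :
    x - y < x * Real.log (x / y) := by
  rcases hx.eq_or_lt with rfl | hx
  · simpa using hy
  · have h1 : y / x ≠ 1 := fun h => hxy (by rw [div_eq_one_iff_eq hx.ne'] at h; exact h.symm)
    have h := Real.log_lt_sub_one_of_pos (div_pos hy hx) h1
    have h2 := mul_lt_mul_of_pos_left h hx
    have h3 : x * (y / x - 1) = y - x := by field_simp
    have h4 : Real.log (x / y) = -Real.log (y / x) := by rw [← Real.log_inv, inv_div]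
    rw [h4]
    linarith

lemma exists_pos_of_mem_rowStochastic {P : Matrix V V ℝ} (hP : P ∈ Matrix.rowStochastic ℝ V)
    (i : V) : ∃ j, 0 < P i j := by
  by_contra! h
  have := Finset.sum_nonpos fun j (_ : j ∈ Finset.univ) => h j
  linarith [Matrix.sum_row_of_mem_rowStochastic hP i]

lemma HasFullSupport.rowSum_pos {P : Matrix V V ℝ} (hP : P ∈ Matrix.rowStochastic ℝ V)
    {θ : V → V → ℝ} (hθ : HasFullSupport P θ) (i : V) : 0 < rowSum θ i := by
  obtain ⟨j, hj⟩ := exists_pos_of_mem_rowStochastic hP i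
  exact (hθ.2 i j hj).trans_le (le_rowSum hθ.1.2.2.1 i j)

/-- Entrywise Gibbs inequality for `x = η i j`, `m = rowSum η i`, `q = Q i j`. The two implications
express absolute continuity and exclude the spurious values of division and logarithm at zero. -/
lemma sub_mul_lt_mul_log {x m q : ℝ} (hx : 0 ≤ x) (hm : 0 ≤ m) (hq : 0 ≤ q)
    (hxm : m = 0 → x = 0) (hxq : q = 0 → x = 0) (hne : x ≠ m * q) :
    x - m * q < x * Real.log (x / m) - x * Real.log q := by
  rcases hm.eq_or_lt with rfl | hm
  · simp [hxm rfl] at hne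
  rcases hq.eq_or_lt with rfl | hq
  · simp [hxq rfl] at hne
  have h := sub_lt_mul_log_div hx (mul_pos hm hq) hne
  rcases hx.eq_or_lt with rfl | hx
  · simpa using h
  · rwa [← mul_sub, ← Real.log_div (by positivity) hq.ne', div_div]

lemma sub_mul_le_mul_log {x m q : ℝ} (hx : 0 ≤ x) (hm : 0 ≤ m) (hq : 0 ≤ q)
    (hxm : m = 0 → x = 0) (hxq : q = 0 → x = 0) :
    x - m * q ≤ x * Real.log (x / m) - x * Real.log q := by
  by_cases hne : x = m * q
  · rcases hx.eq_or_lt with rfl | hx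
    · simp [← hne]
    · have hm0 : m ≠ 0 := fun h => hx.ne' (hxm h)
      rw [hne, mul_div_cancel_left₀ q hm0, sub_self, sub_self]
  · exact (sub_mul_lt_mul_log hx hm hq hxm hxq hne).le

/-- Gibbs' inequality for transition matrices, in strict form. -/
lemma entropy_add_crossEntropy_neg {P : Matrix V V ℝ} (hP : P ∈ Matrix.rowStochastic ℝ V)
    (hirr : P.IsIrreducible) {θ η : V → V → ℝ} (hθ : HasFullSupport P θ)
    (hη : η ∈ typePolytope P) (hne : η ≠ θ) :
    entropy η + ∑ i, ∑ j, η i j * Real.log (θ i j / rowSum θ i) < 0 := by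
  obtain ⟨hη1, hηb, hη0, hηP⟩ := hη
  obtain ⟨hθ1, hθb, hθ0, hθP⟩ := hθ.1
  have hq := fun i => hθ.rowSum_pos hP i
  set Q : V → V → ℝ := fun i j => θ i j / rowSum θ i with hQ
  have hQ0 : ∀ i j, 0 ≤ Q i j := fun i j => div_nonneg (hθ0 i j) (hq i).le
  have hθQ : ∀ i j, rowSum θ i * Q i j = θ i j := fun i j => mul_div_cancel₀ _ (hq i).ne'
  have hQsum : ∀ i, ∑ j, Q i j = 1 := fun i => by
    rw [hQ, ← Finset.sum_div, ← rowSum, div_self (hq i).ne']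
  have hQz : ∀ i j, Q i j = 0 → η i j = 0 := fun i j h => by
    refine hηP i j ?_
    by_contra h0
    have := hθ.2 i j ((Matrix.nonneg_of_mem_rowStochastic hP).lt_of_ne' h0)
    rw [← hθQ, h, mul_zero] at this
    exact this.false
  have hmz : ∀ i j, rowSum η i = 0 → η i j = 0 := fun i j h =>
    (h ▸ le_rowSum hη0 i j).antisymm (hη0 i j)
  -- Equality in every entry would make `rowSum η` stationary for `Q`, hence equal to `rowSum θ`,
  -- and then `η = θ`.
  obtain ⟨i₀, j₀, h0⟩ : ∃ i j, η i j ≠ rowSum η i * Q i j := by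
    by_contra! h
    have hrow : rowSum η = rowSum θ := by
      refine stationary_unique hirr (Q := Q) hQ0
        (fun i j hij => div_pos (hθ.2 i j hij) (hq i)) hq hη1 hθ1 (fun j => ?_) (fun j => ?_)
      · rw [rowSum, hηb]
        exact Finset.sum_congr rfl fun i _ => (h i j).symm
      · rw [Finset.sum_congr rfl fun i _ => hθQ i j]
        exact (hθb j).symm
    exact hne (funext fun i => funext fun j => by rw [h i j, hrow, hθQ])
  have hle := fun i j => sub_mul_le_mul_log (hη0 i j) (rowSum_nonneg hη0 i) (hQ0 i j)
    (hmz i j) (hQz i j)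
  have hlt : ∑ i, ∑ j, (η i j - rowSum η i * Q i j)
      < ∑ i, ∑ j, (η i j * Real.log (η i j / rowSum η i) - η i j * Real.log (Q i j)) := by
    refine Finset.sum_lt_sum (fun i _ => Finset.sum_le_sum fun j _ => hle i j)
      ⟨i₀, Finset.mem_univ _, Finset.sum_lt_sum (fun j _ => hle i₀ j) ⟨j₀, Finset.mem_univ _, ?_⟩⟩
    exact sub_mul_lt_mul_log (hη0 _ _) (rowSum_nonneg hη0 _) (hQ0 _ _) (hmz _ _) (hQz _ _) h0
  have hz : ∑ i, ∑ j, (η i j - rowSum η i * Q i j) = 0 := by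
    refine Finset.sum_eq_zero fun i _ => ?_
    rw [Finset.sum_sub_distrib, ← Finset.mul_sum, hQsum, mul_one, ← rowSum, sub_self]
  have he : entropy η = - ∑ i, ∑ j, η i j * Real.log (η i j / rowSum η i) := rfl
  simp only [Finset.sum_sub_distrib] at hlt hz
  linarith

omit [DecidableEq V] in
lemma convexCombo_mem_typePolytope {P : Matrix V V ℝ} {θ η : V → V → ℝ}
    (hθ : θ ∈ typePolytope P) (hη : η ∈ typePolytope P) {a b : ℝ} (ha : 0 ≤ a) (hb : 0 ≤ b)
    (hab : a + b = 1) : a • θ + b • η ∈ typePolytope P := by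
  obtain ⟨hη1, hηb, hη0, hηP⟩ := hη
  obtain ⟨hθ1, hθb, hθ0, hθP⟩ := hθ
  refine ⟨?_, fun i => ?_, fun i j => ?_, fun i j hij => ?_⟩ <;>
    simp only [Pi.add_apply, Pi.smul_apply, smul_eq_mul, Finset.sum_add_distrib, ← Finset.mul_sum]
  · rw [hη1, hθ1]; linarith
  · rw [hηb, hθb]
  · exact add_nonneg (mul_nonneg ha (hθ0 i j)) (mul_nonneg hb (hη0 i j))
  · rw [hηP i j hij, hθP i j hij]; simp

omit [DecidableEq V] in
lemma HasFullSupport.convexCombo {P : Matrix V V ℝ} {θ η : V → V → ℝ}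
    (hθ : θ ∈ typePolytope P) (hη : HasFullSupport P η) {a b : ℝ} (ha : 0 ≤ a) (hb : 0 < b)
    (hab : a + b = 1) : HasFullSupport P (a • θ + b • η) := by
  refine ⟨convexCombo_mem_typePolytope hθ hη.1 ha hb.le hab, fun i j hij => ?_⟩
  simp only [Pi.add_apply, Pi.smul_apply, smul_eq_mul]
  exact add_pos_of_nonneg_of_pos (mul_nonneg ha (hθ.2.2.1 i j)) (mul_pos hb (hη.2 i j hij))

lemma IsStationary.hasFullSupport {P : Matrix V V ℝ} (hP : P ∈ Matrix.rowStochastic ℝ V)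
    (hirr : P.IsIrreducible) {π : V → ℝ} (hπ : IsStationary π P) :
    HasFullSupport P fun i j => π i * P i j := by
  refine ⟨⟨?_, fun i => ?_, fun i j => ?_, fun i j hij => ?_⟩, fun i j hij => ?_⟩
  · simp_rw [← Finset.mul_sum, Matrix.sum_row_of_mem_rowStochastic hP, mul_one, hπ.sum_eq_one]
  · rw [← Finset.mul_sum, Matrix.sum_row_of_mem_rowStochastic hP, mul_one, hπ.stationary]
  · exact mul_nonneg (hπ.nonneg i) (hirr.nonneg i j)
  · simp only [hij, mul_zero]
  · exact mul_pos (hπ.pos hirr i) hij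

/-! ### The Gaussian cost -/

/-- The Legendre-type expression whose supremum over `l` is the Gaussian cost. -/
noncomputable def dualCost (l : V → ℝ) (x : (V → V → ℝ) × (V → ℝ)) : ℝ :=
  ∑ i, (l i * x.2 i - rowSum x.1 i * (l i ^ 2 / 2))

omit [DecidableEq V] in
lemma continuous_dualCost (l : V → ℝ) : Continuous (dualCost l) := by
  unfold dualCost
  have := fun i => (continuous_rowSum (V := V) i).comp
    (continuous_fst : Continuous fun x : (V → V → ℝ) × (V → ℝ) => x.1)
  simp only [Function.comp_def] at this
  fun_prop

omit [DecidableEq V] in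
lemma dualCost_le_gaussCost (l : V → ℝ) {x : (V → V → ℝ) × (V → ℝ)}
    (hx : ∀ i j, 0 ≤ x.1 i j) : (dualCost l x : EReal) ≤ gaussCost x.1 x.2 := by
  unfold gaussCost
  split_ifs with h
  · rw [EReal.coe_le_coe_iff, dualCost, Finset.sum_filter]
    refine Finset.sum_le_sum fun i _ => ?_
    rcases (rowSum_nonneg hx i).eq_or_lt with h0 | h0
    · simp [← h0, h i h0.symm]
    · rw [if_pos h0, div_mul_eq_mul_div, one_mul, le_div_iff₀ h0]
      nlinarith [sq_nonneg (l i * rowSum x.1 i - x.2 i)]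
  · exact le_top

/-- The maximizer is `l i = ξ i / rowSum θ i`. When the cost is infinite, some `ξ i ≠ 0` sits on a
row of mass zero, where `dualCost` is linear in `l i` and so unbounded. -/
lemma exists_dualCost_gt {x : (V → V → ℝ) × (V → ℝ)} (hx : ∀ i j, 0 ≤ x.1 i j) {b : ℝ}
    (hb : (b : EReal) < gaussCost x.1 x.2) : ∃ l : V → ℝ, b < dualCost l x := by
  unfold gaussCost at hb
  split_ifs at hb with h
  · refine ⟨fun i => x.2 i / rowSum x.1 i, ?_⟩
    rw [EReal.coe_lt_coe_iff, Finset.sum_filter] at hb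
    refine hb.trans_le (le_of_eq ?_)
    rw [dualCost]
    refine Finset.sum_congr rfl fun i _ => ?_
    rcases (rowSum_nonneg hx i).eq_or_lt with h0 | h0
    · simp [← h0]
    · rw [if_pos h0]
      field_simp
      ring
  · push Not at h
    obtain ⟨i, hi, hxi⟩ := h
    refine ⟨Pi.single i ((b + 1) / x.2 i), ?_⟩
    rw [dualCost, Finset.sum_eq_single i]
    · rw [Pi.single_eq_same, hi, div_mul_cancel₀ _ hxi]
      linarith
    · intro j _ hj
      simp [Pi.single_eq_of_ne hj]
    · simp

omit [DecidableEq V] in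
lemma gaussCost_nonneg {x : (V → V → ℝ) × (V → ℝ)} (hx : ∀ i j, 0 ≤ x.1 i j) :
    0 ≤ gaussCost x.1 x.2 := by
  refine le_trans (le_of_eq ?_) (dualCost_le_gaussCost 0 hx)
  simp [dualCost]

/-- Merges the two ways for the rate to exceed `a`: either `J > H`, so that the rate is infinite, or
`J > H + a - log ρ₀`. The minimum with zero selects the weaker requirement. -/
lemma lt_rate_iff {P : Matrix V V ℝ} {x : (V → V → ℝ) × (V → ℝ)} {a : ℝ} :
    (a : EReal) < rate P x ↔ (x.1 ∈ typePolytope P →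
      ((entropy x.1 + min 0 (a - Real.log (rho P)) : ℝ) : EReal) < gaussCost x.1 x.2) := by
  by_cases hx : x.1 ∈ typePolytope P
  swap
  · simp [rate, hx]
  have h0 := gaussCost_nonneg hx.2.2.1
  rw [rate]
  induction h : gaussCost x.1 x.2 with
  | bot => simp [h] at h0
  | top =>
    rw [if_neg (by simp)]
    exact ⟨fun _ _ => EReal.coe_lt_top _, fun _ => EReal.coe_lt_top _⟩
  | coe c =>
    simp only [hx, true_and, forall_const, EReal.coe_le_coe_iff, EReal.coe_lt_coe_iff]
    split_ifs with hc
    · rw [← EReal.coe_add, EReal.coe_lt_coe_iff, ← lt_sub_iff_add_lt', min_lt_iff]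
      constructor
      · intro h; right; linarith
      · rintro (h | h) <;> linarith
    · rw [← lt_sub_iff_add_lt', min_lt_iff]
      simp only [EReal.coe_lt_top, true_iff]
      left; linarith

/-- On the closed polytope the entropy is continuous, and the Gaussian cost is a supremum of the
continuous functions `dualCost l`. -/
lemma lowerSemicontinuous_rate (P : Matrix V V ℝ) : LowerSemicontinuous (rate P) := by
  intro x y hy
  by_cases hx : x.1 ∈ typePolytope P
  swap
  · filter_upwards [continuous_fst.continuousAt.preimage_mem_nhds
      ((isClosed_typePolytope P).isOpen_compl.mem_nhds hx)] with z hz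
    rw [rate, if_neg fun h => hz h.1]
    exact hy.trans_le le_top
  have hent : ∀ δ > 0, ∀ᶠ z in nhds x, z.1 ∈ typePolytope P → entropy z.1 < entropy x.1 + δ := by
    intro δ hδ
    have h1 := (continuousOn_entropy x.1 hx.2.2.1).eventually_lt_const
      (show entropy x.1 < entropy x.1 + δ by linarith)
    rw [eventually_nhdsWithin_iff] at h1
    filter_upwards [continuous_fst.continuousAt.eventually h1] with z hz hzP
    exact hz hzP.2.2.1
  have hcost : ∀ β : ℝ, (β : EReal) < gaussCost x.1 x.2 →
      ∀ᶠ z in nhds x, z.1 ∈ typePolytope P → (β : EReal) < gaussCost z.1 z.2 := by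
    intro β hβ
    obtain ⟨l, hl⟩ := exists_dualCost_gt hx.2.2.1 hβ
    filter_upwards [(continuous_dualCost l).continuousAt.eventually_const_lt hl] with z hz hzP
    exact (EReal.coe_lt_coe_iff.2 hz).trans_le (dualCost_le_gaussCost l hzP.2.2.1)
  obtain ⟨a, hya, hax⟩ := EReal.lt_iff_exists_real_btwn.1 hy
  obtain ⟨β, hβ, hβJ⟩ := EReal.lt_iff_exists_real_btwn.1 (lt_rate_iff.1 hax hx)
  rw [EReal.coe_lt_coe_iff] at hβ
  filter_upwards [hent _ (sub_pos.2 hβ), hcost β hβJ] with z hz1 hz2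
  refine hya.trans (lt_rate_iff.2 fun hz => lt_trans ?_ (hz2 hz))
  rw [EReal.coe_lt_coe_iff]
  linarith [hz1 hz]

/-! ### Counting sequences by type -/

open Classical in
/-- The number of sequences of a given length whose type has a small cross entropy against a
positive transition matrix. -/
lemma card_crossEntropy_lt_le {Q : Matrix V V ℝ} (hQ : Q ∈ Matrix.rowStochastic ℝ V)
    (hQ0 : ∀ i j, 0 < Q i j) {t : ℕ} (ht : 0 < t) (b : ℝ) :
    ((Finset.univ.filter fun s : Fin t → V =>
      -∑ i, ∑ j, markovType s i j * Real.log (Q i j) < b).card : ℝ)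
      ≤ Fintype.card V * Real.exp (t * b) := by
  obtain ⟨n, rfl⟩ := Nat.exists_eq_succ_of_ne_zero ht.ne'
  set S := Finset.univ.filter fun s : Fin (n + 1) → V =>
      -∑ i, ∑ j, markovType s i j * Real.log (Q i j) < b
  -- Each sequence in `S` has `Q`-weight at least `exp (-t b)`, because dropping the closing
  -- transition only increases the weight; with initial weight one at every state the total is `card
  -- V`.
  have h1 : ∀ s ∈ S, Real.exp (-(((n + 1 : ℕ) : ℝ) * b)) ≤ pathProb (fun _ => 1) Q (n + 1) s := by
    intro s hs
    have hs := (Finset.mem_filter.1 hs).2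
    rw [pathProb_eq_exp _ _ _ fun k => hQ0 _ _, one_mul, Real.exp_le_exp]
    have hlog : Real.log (Q (s (Fin.last n)) (s 0)) ≤ 0 :=
      Real.log_nonpos (hQ0 _ _).le (Matrix.le_one_of_mem_rowStochastic hQ)
    have h := mul_le_mul_of_nonneg_left hs.le (Nat.cast_nonneg (α := ℝ) (n + 1))
    linarith
  have h2 : (S.card : ℝ) * Real.exp (-(((n + 1 : ℕ) : ℝ) * b)) ≤ Fintype.card V := by
    calc (S.card : ℝ) * Real.exp (-(((n + 1 : ℕ) : ℝ) * b))
        = ∑ s ∈ S, Real.exp (-(((n + 1 : ℕ) : ℝ) * b)) := by rw [Finset.sum_const, nsmul_eq_mul]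
      _ ≤ ∑ s ∈ S, pathProb (fun _ => 1) Q (n + 1) s := Finset.sum_le_sum h1
      _ ≤ ∑ s, pathProb (fun _ => 1) Q (n + 1) s := by
          refine Finset.sum_le_sum_of_subset_of_nonneg (Finset.subset_univ _) fun s _ _ => ?_
          rw [pathProb, one_mul]
          exact Finset.prod_nonneg fun k _ => (hQ0 _ _).le
      _ = Fintype.card V := by
          rw [sum_pathProb_of_mem_rowStochastic _ hQ]
          simp
  rwa [Real.exp_neg, ← div_eq_mul_inv, div_le_iff₀ (Real.exp_pos _)] at h2

/-- Types satisfy normalization, balance and positivity exactly, and the support condition up to `1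
/ t`; a violated condition therefore excludes a neighbourhood. -/
lemma exists_isOpen_forall_markovType_notMem {P : Matrix V V ℝ} (hP : ∀ i j, 0 ≤ P i j)
    {π : V → ℝ} (hπ : ∀ i, 0 < π i) {θ : V → V → ℝ} (hθ : θ ∉ typePolytope P) :
    ∃ U, IsOpen U ∧ θ ∈ U ∧ ∀ᶠ t : ℕ in atTop, ∀ s ∈ feasible π P t, markovType s ∉ U := by
  by_cases h1 : ∑ i, ∑ j, θ i j = 1
  swap
  · refine ⟨{η | ∑ i, ∑ j, η i j ≠ 1}, isOpen_ne_fun (by fun_prop) (by fun_prop), h1, ?_⟩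
    filter_upwards [eventually_gt_atTop 0] with t ht s _ hs
    exact hs (sum_markovType_eq_one ht s)
  by_cases h2 : ∀ i, ∑ j, θ i j = ∑ j, θ j i
  swap
  · push Not at h2
    obtain ⟨i, hi⟩ := h2
    refine ⟨{η | ∑ j, η i j ≠ ∑ j, η j i}, isOpen_ne_fun (by fun_prop) (by fun_prop), hi, ?_⟩
    filter_upwards [eventually_gt_atTop 0] with t ht s _ hs
    exact hs (markovType_balanced ht s i)
  by_cases h3 : ∀ i j, 0 ≤ θ i j
  swap
  · push Not at h3
    obtain ⟨i, j, hij⟩ := h3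
    refine ⟨{η | η i j < 0}, isOpen_lt (by fun_prop) (by fun_prop), hij, ?_⟩
    exact Eventually.of_forall fun t s _ hs => absurd (markovType_nonneg s i j) (not_le.2 hs)
  · have h4 : ¬ ∀ i j, P i j = 0 → θ i j = 0 := fun h => hθ ⟨h1, h2, h3, h⟩
    push Not at h4
    obtain ⟨i, j, hij, hne⟩ := h4
    have hpos : 0 < θ i j := (h3 i j).lt_of_ne' hne
    refine ⟨{η | θ i j / 2 < η i j}, isOpen_lt (by fun_prop) (by fun_prop), ?_, ?_⟩
    · simp only [Set.mem_ofPred_eq]; linarith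
    · have hlim : Tendsto (fun t : ℕ => 1 / (t : ℝ)) atTop (nhds 0) :=
        tendsto_one_div_atTop_nhds_zero_nat
      filter_upwards [hlim.eventually_lt_const (half_pos hpos)] with t ht s hs hsU
      exact absurd (markovType_le_of_eq_zero hP hπ hs hij) (not_le.2 (ht.trans hsU))

/-! ### Lower bound for the number of sequences of a given type -/

section LowerBound

variable {P : Matrix V V ℝ} (hP : P ∈ Matrix.rowStochastic ℝ V) (hirr : P.IsIrreducible)
  {π : V → ℝ} (hπ : ∀ i, 0 < π i) {θ : V → V → ℝ} (hθ : HasFullSupport P θ)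

/-- The Markov transition matrix with pair distribution `θ`. -/
noncomputable def transition (θ : V → V → ℝ) : Matrix V V ℝ :=
  Matrix.of fun i j => θ i j / rowSum θ i

include hP hθ in
lemma transition_mem_rowStochastic : transition θ ∈ Matrix.rowStochastic ℝ V := by
  rw [Matrix.mem_rowStochastic_iff_sum]
  refine ⟨fun i j => div_nonneg (hθ.1.2.2.1 i j) (hθ.rowSum_pos hP i).le, fun i => ?_⟩
  simp only [transition, Matrix.of_apply]
  rw [← Finset.sum_div, ← rowSum, div_self (hθ.rowSum_pos hP i).ne']

include hP hθ in
lemma transition_pos_iff {i j : V} : 0 < transition θ i j ↔ 0 < P i j := by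
  have hq := hθ.rowSum_pos hP i
  simp only [transition, Matrix.of_apply, div_pos_iff_of_pos_right hq]
  refine ⟨fun h => ?_, hθ.2 i j⟩
  by_contra h0
  have := hθ.1.2.2.2 i j ((not_lt.1 h0).antisymm (Matrix.nonneg_of_mem_rowStochastic hP))
  exact h.ne' this

include hP hθ in
lemma pathProb_transition_nonneg {n : ℕ} (s : Fin (n + 1) → V) :
    0 ≤ pathProb (rowSum θ) (transition θ) (n + 1) s := by
  rw [pathProb]
  exact mul_nonneg (rowSum_nonneg hθ.1.2.2.1 _) (Finset.prod_nonneg fun k _ =>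
    Matrix.nonneg_of_mem_rowStochastic (transition_mem_rowStochastic hP hθ))

include hP hπ hθ in
lemma sum_feasible_pathProb_transition (n : ℕ) :
    ∑ s ∈ feasible π P (n + 1), pathProb (rowSum θ) (transition θ) (n + 1) s = 1 := by
  have h1 : ∑ i, rowSum θ i = 1 := hθ.1.1
  rw [← h1, ← sum_pathProb_of_mem_rowStochastic (rowSum θ) (transition_mem_rowStochastic hP hθ) n]
  refine Finset.sum_subset (Finset.subset_univ _) fun s _ hs => ?_
  rw [mem_feasible_succ (fun i j => Matrix.nonneg_of_mem_rowStochastic hP) hπ] at hs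
  push Not at hs
  obtain ⟨k, hk⟩ := hs
  rw [pathProb, Finset.prod_eq_zero (Finset.mem_univ k), mul_zero]
  refine le_antisymm ?_
    (Matrix.nonneg_of_mem_rowStochastic (transition_mem_rowStochastic hP hθ))
  exact not_lt.1 fun h => absurd ((transition_pos_iff hP hθ).1 h) (not_lt.2 hk)

include hP hπ hθ in
-- The constant absorbs the closing transition, whichever pair of states it joins.
lemma exists_pathProb_transition_le : ∃ C > 0, ∀ n : ℕ, ∀ s ∈ feasible π P (n + 1),
    pathProb (rowSum θ) (transition θ) (n + 1) s ≤ C * Real.exp (((n + 1 : ℕ) : ℝ) *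
      ∑ i, ∑ j, markovType s i j * Real.log (transition θ i j)) := by
  refine ⟨Real.exp (∑ i, ∑ j, |Real.log (transition θ i j)|), Real.exp_pos _, fun n s hs => ?_⟩
  rw [mem_feasible_succ (fun i j => Matrix.nonneg_of_mem_rowStochastic hP) hπ] at hs
  rw [pathProb_eq_exp _ _ _ fun k => (transition_pos_iff hP hθ).2 (hs k), ← Real.exp_add]
  have h1 : rowSum θ (s 0) ≤ 1 := by
    rw [← hθ.1.1]
    exact Finset.single_le_sum (f := fun i => rowSum θ i)
      (fun i _ => rowSum_nonneg hθ.1.2.2.1 i) (Finset.mem_univ _)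
  refine (mul_le_of_le_one_left (Real.exp_pos _).le h1).trans (Real.exp_le_exp.2 ?_)
  have h2 : |Real.log (transition θ (s (Fin.last n)) (s 0))|
      ≤ ∑ i, ∑ j, |Real.log (transition θ i j)| :=
    (Finset.single_le_sum (f := fun j => |Real.log (transition θ (s (Fin.last n)) j)|)
      (fun j _ => abs_nonneg _) (Finset.mem_univ _)).trans
    (Finset.single_le_sum (f := fun i => ∑ j, |Real.log (transition θ i j)|)
      (fun i _ => Finset.sum_nonneg fun j _ => abs_nonneg _) (Finset.mem_univ _))
  have h3 := neg_abs_le (Real.log (transition θ (s (Fin.last n)) (s 0)))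
  linarith

open Classical in
include hP hirr hπ hθ in
/-- Types different from `θ` have locally vanishing probability under the chain with pair
distribution `θ`. -/
lemma exists_isOpen_tendsto_pathProb {η : V → V → ℝ} (hne : η ≠ θ) :
    ∃ U, IsOpen U ∧ η ∈ U ∧ Tendsto (fun n : ℕ =>
      ∑ s ∈ feasible π P (n + 1) with markovType s ∈ U,
        pathProb (rowSum θ) (transition θ) (n + 1) s) atTop (nhds 0) := by
  by_cases hη : η ∈ typePolytope P
  swap
  · obtain ⟨U, hU, hηU, h⟩ := exists_isOpen_forall_markovType_notMem
      (fun i j => Matrix.nonneg_of_mem_rowStochastic hP) hπ hη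
    refine ⟨U, hU, hηU, tendsto_const_nhds.congr' ?_⟩
    filter_upwards [(tendsto_add_atTop_nat 1).eventually h] with n hn
    rw [Finset.filter_false_of_mem hn, Finset.sum_empty]
  obtain ⟨C, hC0, hC⟩ := exists_pathProb_transition_le hP hπ hθ
  have hgap := entropy_add_crossEntropy_neg hP hirr hθ hη hne
  have hV : Nonempty V := by
    by_contra h
    rw [not_nonempty_iff] at h
    have := hθ.1.1
    simp at this
  -- Strict Gibbs leaves room for `b < c`: near `η` there are at most `card V * exp (t b)`
  -- sequences, each of probability at most `C * exp (-t c)`.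
  obtain ⟨b, hb1, hb2⟩ := exists_between (show entropy η
    < -∑ i, ∑ j, η i j * Real.log (transition θ i j) by
      simp only [transition, Matrix.of_apply]; linarith)
  obtain ⟨c, hc1, hc2⟩ := exists_between hb2
  obtain ⟨Q, hQ, hQ0, hQb⟩ := exists_crossEntropy_lt hη.2.2.1 hη.1 hb1
  obtain ⟨W, hWo, hηW, hWQ, hWθ⟩ : ∃ W : Set (V → V → ℝ), IsOpen W ∧ η ∈ W ∧
      (∀ ζ ∈ W, -∑ i, ∑ j, ζ i j * Real.log (Q i j) < b) ∧
      ∀ ζ ∈ W, c < -∑ i, ∑ j, ζ i j * Real.log (transition θ i j) :=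
    ⟨{ζ | -∑ i, ∑ j, ζ i j * Real.log (Q i j) < b} ∩
      {ζ | c < -∑ i, ∑ j, ζ i j * Real.log (transition θ i j)},
      (isOpen_lt (continuous_pairing _).neg continuous_const).inter
        (isOpen_lt continuous_const (continuous_pairing _).neg), ⟨hQb, hc2⟩,
      fun ζ h => h.1, fun ζ h => h.2⟩
  refine ⟨W, hWo, hηW, ?_⟩
  have hlim : Tendsto (fun n : ℕ => Fintype.card V * C *
      Real.exp (((n + 1 : ℕ) : ℝ) * (b - c))) atTop (nhds 0) := by
    rw [← mul_zero (Fintype.card V * C : ℝ)]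
    have h : Tendsto (fun n : ℕ => ((n : ℝ) * (b - c))) atTop atBot :=
      tendsto_natCast_atTop_atTop.atTop_mul_const_of_neg (by linarith)
    exact ((Real.tendsto_exp_atBot.comp h).comp (tendsto_add_atTop_nat 1)).const_mul _
  refine squeeze_zero (fun n => Finset.sum_nonneg fun s _ => pathProb_transition_nonneg hP hθ s)
    (fun n => ?_) hlim
  have hterm : ∀ s ∈ (feasible π P (n + 1)).filter (fun s => markovType s ∈ W),
      pathProb (rowSum θ) (transition θ) (n + 1) s
        ≤ C * Real.exp (((n + 1 : ℕ) : ℝ) * (-c)) := by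
    intro s hs
    obtain ⟨hs1, hs2⟩ := Finset.mem_filter.1 hs
    refine (hC n s hs1).trans ?_
    have := hWθ _ hs2
    gcongr
    linarith
  refine (Finset.sum_le_card_nsmul _ _ _ hterm).trans ?_
  rw [nsmul_eq_mul]
  have hcard := card_crossEntropy_lt_le hQ hQ0 n.succ_pos b
  calc _ ≤ (Fintype.card V * Real.exp (((n + 1 : ℕ) : ℝ) * b)) *
        (C * Real.exp (((n + 1 : ℕ) : ℝ) * (-c))) := by
        refine mul_le_mul_of_nonneg_right (le_trans ?_ hcard) (by positivity)
        norm_cast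
        refine Finset.card_le_card fun s hs => ?_
        exact Finset.mem_filter.2 ⟨Finset.mem_univ _, hWQ _ (Finset.mem_filter.1 hs).2⟩
    _ = Fintype.card V * C * Real.exp (((n + 1 : ℕ) : ℝ) * (b - c)) := by
        rw [mul_sub, sub_eq_add_neg, Real.exp_add, mul_neg]
        ring

open Classical in
include hP hirr hπ hθ in
/-- The number of feasible sequences with type near `θ` grows at least with the entropy of `θ`. -/
lemma exp_le_card_markovType_mem {U : Set (V → V → ℝ)} (hU : IsOpen U) (hθU : θ ∈ U) {a : ℝ}
    (ha : a < entropy θ) : ∀ᶠ t : ℕ in atTop,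
      Real.exp (t * a) ≤ ((feasible π P t).filter fun s => markovType s ∈ U).card := by
  obtain ⟨b, hab, hb⟩ := exists_between ha
  -- The extra condition caps the probability of each sequence with type in `U'` by `C * exp (-t
  -- b)`, so mass one half requires at least `exp (t b) / (2 C)` of them.
  set U' := U ∩ {η | b < -∑ i, ∑ j, η i j * Real.log (transition θ i j)} with hU'
  have hU'o : IsOpen U' := hU.inter (isOpen_lt continuous_const (continuous_pairing _).neg)
  have hθU' : θ ∈ U' := ⟨hθU, hb⟩
  obtain ⟨C, hC0, hC⟩ := exists_pathProb_transition_le hP hπ hθ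
  -- All types lie in the unit cube, so finitely many neighbourhoods of vanishing probability cover
  -- those outside `U'`.
  set K : Set (V → V → ℝ) := Set.Icc 0 1 \ U' with hK
  have hKc : IsCompact K := isCompact_Icc.diff hU'o
  have hloc : ∀ η ∈ K, ∃ W, IsOpen W ∧ η ∈ W ∧ Tendsto (fun n : ℕ =>
      ∑ s ∈ feasible π P (n + 1) with markovType s ∈ W,
        pathProb (rowSum θ) (transition θ) (n + 1) s) atTop (nhds 0) := fun η hη =>
    exists_isOpen_tendsto_pathProb hP hirr hπ hθ fun h => hη.2 (h ▸ hθU')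
  choose! W hWo hηW hW using hloc
  obtain ⟨T, hTK, hTcov⟩ := hKc.elim_nhds_subcover W fun η hη => (hWo η hη).mem_nhds (hηW η hη)
  have hsum : Tendsto (fun n : ℕ => ∑ η ∈ T, ∑ s ∈ feasible π P (n + 1) with markovType s ∈ W η,
        pathProb (rowSum θ) (transition θ) (n + 1) s) atTop (nhds 0) := by
    rw [← Finset.sum_const_zero (s := T)]
    exact tendsto_finsetSum _ fun η hη => hW η (hTK η hη)
  rw [← map_add_atTop_eq_nat 1]
  refine eventually_map.2 ?_
  filter_upwards [hsum.eventually_lt_const (show (0 : ℝ) < 1 / 2 by norm_num),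
    (tendsto_add_atTop_nat 1).eventually (eventually_const_mul_exp_le (2 * C) hab)] with n hn hexp
  set F := feasible π P (n + 1)
  set w := pathProb (rowSum θ) (transition θ) (n + 1)
  have hw0 : ∀ s, 0 ≤ w s := pathProb_transition_nonneg hP hθ
  have hbad : ∑ s ∈ F with markovType s ∉ U', w s 
      ≤ ∑ η ∈ T, ∑ s ∈ F with markovType s ∈ W η, w s := by
    simp_rw [Finset.sum_filter]
    rw [Finset.sum_comm]
    refine Finset.sum_le_sum fun s _ => ?_
    have hterm : ∀ η ∈ T, 0 ≤ if markovType s ∈ W η then w s else 0 := fun η _ => by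
      split_ifs
      exacts [hw0 s, le_rfl]
    split_ifs with hs
    · exact Finset.sum_nonneg hterm
    · obtain ⟨η, hηT, hη⟩ := Set.mem_iUnion₂.1 (hTcov ⟨⟨fun i j => markovType_nonneg s i j,
        fun i j => markovType_le_one n.succ_pos s i j⟩, hs⟩)
      exact (if_pos hη).ge.trans (Finset.single_le_sum hterm hηT)
  have hgood : (1 : ℝ) / 2 ≤ ∑ s ∈ F with markovType s ∈ U', w s := by
    have := Finset.sum_filter_add_sum_filter_not F (fun s => markovType s ∈ U') w
    rw [sum_feasible_pathProb_transition hP hπ hθ] at this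
    linarith
  have hle : ∑ s ∈ F with markovType s ∈ U', w s
      ≤ (F.filter fun s => markovType s ∈ U).card *
        (C * Real.exp (((n + 1 : ℕ) : ℝ) * (-b))) := by
    rw [← nsmul_eq_mul, ← Finset.sum_const]
    refine (Finset.sum_le_sum fun s hs => ?_).trans
      (Finset.sum_le_sum_of_subset_of_nonneg (fun s hs => ?_) fun s _ _ => by positivity)
    · obtain ⟨hs1, -, hs2⟩ := Finset.mem_filter.1 hs
      refine (hC n s hs1).trans ?_
      have : b < -∑ i, ∑ j, markovType s i j * Real.log (transition θ i j) := hs2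
      gcongr
      linarith
    · exact Finset.mem_filter.2 ⟨(Finset.mem_filter.1 hs).1, (Finset.mem_filter.1 hs).2.1⟩
  rw [mul_neg, Real.exp_neg] at hle
  have hpos := Real.exp_pos (((n + 1 : ℕ) : ℝ) * b)
  have h2 : Real.exp (((n + 1 : ℕ) : ℝ) * b)
      ≤ 2 * C * (F.filter fun s => markovType s ∈ U).card := by
    have := hgood.trans hle
    rw [← div_eq_mul_inv, mul_div_assoc', le_div_iff₀ hpos] at this
    linarith
  have h3 := hexp.trans h2
  exact le_of_mul_le_mul_left h3 (by positivity)

end LowerBound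

/-! ### Gaussian estimates for a single sequence -/

section SingleSequence

variable {Ω : Type*} [MeasurableSpace Ω] {μ : Measure Ω} [IsProbabilityMeasure μ]
  {t : ℕ} {X : Fin t → Ω → ℝ} (hXmeas : ∀ k, Measurable (X k))
  (hXlaw : ∀ k, HasLaw (X k) (gaussianReal 0 1) μ) (hXindep : iIndepFun X μ)

/-- The right side is the log-likelihood ratio for shifting the mean of each `z k` to `l (s k)`; its
exponential has expectation one under the standard Gaussian law. -/
lemma mul_dualCost_type (ht : 0 < t) (s : Fin t → V) (l : V → ℝ) (z : Fin t → ℝ) :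
    t * dualCost l (markovType s, signalType s z)
      = ∑ k, (l (s k) * z k - l (s k) ^ 2 / 2) := by
  have ht0 : (t : ℝ) ≠ 0 := by positivity
  rw [dualCost, Finset.sum_sub_distrib, Finset.sum_sub_distrib, mul_sub]
  congr 1
  · rw [Finset.mul_sum, ← Finset.sum_fiberwise (s := Finset.univ) (g := s)]
    refine Finset.sum_congr rfl fun i _ => ?_
    simp only [signalType]
    have h : ∑ k with s k = i, l (s k) * z k = ∑ k with s k = i, l i * z k :=
      Finset.sum_congr rfl fun k hk => by rw [(Finset.mem_filter.1 hk).2]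
    rw [h, ← Finset.mul_sum]
    field_simp
  · rw [← sum_markovType ht s fun i _ => l i ^ 2 / 2]
    congr 1
    refine Finset.sum_congr rfl fun i _ => ?_
    rw [← Finset.sum_mul, rowSum]

omit [Fintype V] in
lemma measurable_signalType (s : Fin t → V) :
    Measurable fun z : Fin t → ℝ => signalType s z := by
  unfold signalType; fun_prop

omit [Fintype V] in
include hXmeas in
lemma measurable_type (s : Fin t → V) :
    Measurable fun ω => (markovType s, signalType s fun k => X k ω) :=
  measurable_const.prodMk ((measurable_signalType s).comp (measurable_pi_lambda _ hXmeas))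

include hXmeas hXlaw hXindep in
lemma integrable_exp_dualCost (ht : 0 < t) (s : Fin t → V) (l : V → ℝ) :
    Integrable (fun ω => Real.exp (t * dualCost l (markovType s, signalType s fun k => X k ω))) μ ∧
    ∫ ω, Real.exp (t * dualCost l (markovType s, signalType s fun k => X k ω)) ∂μ = 1 := by
  set Y : Fin t → Ω → ℝ := fun k ω => l (s k) * X k ω with hY
  have hYm : ∀ k, Measurable (Y k) := fun k => (hXmeas k).const_mul _
  have hYi : iIndepFun Y μ := hXindep.comp (fun k x => l (s k) * x) fun k => by fun_prop
  have hint : ∀ k, Integrable (fun ω => Real.exp (1 * Y k ω)) μ := by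
    intro k
    have h := (hXlaw k).map_eq ▸ integrable_exp_mul_gaussianReal (μ := 0) (v := 1) (l (s k))
    have h2 := h.comp_aemeasurable (hXlaw k).aemeasurable
    simpa [Function.comp_def, hY] using h2
  have hmgf : ∀ k, mgf (Y k) μ 1 = Real.exp (l (s k) ^ 2 / 2) := by
    intro k
    have h := mgf_gaussianReal (hXlaw k).map_eq (l (s k))
    simp only [mgf] at h ⊢
    simpa [hY] using h
  have heq : (fun ω => Real.exp (t * dualCost l (markovType s, signalType s fun k => X k ω)))
      = fun ω => Real.exp (-∑ k, l (s k) ^ 2 / 2) * Real.exp (1 * (∑ k, Y k) ω) := by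
    funext ω
    rw [mul_dualCost_type ht, ← Real.exp_add, Finset.sum_apply, Finset.sum_sub_distrib]
    congr 1
    simp only [hY]
    ring
  rw [heq]
  refine ⟨(hYi.integrable_exp_mul_sum hYm fun k _ => hint k).const_mul _, ?_⟩
  rw [integral_const_mul]
  have h := hYi.mgf_sum (t := 1) hYm Finset.univ
  rw [mgf] at h
  rw [h, Finset.prod_congr rfl fun k _ => hmgf k, ← Real.exp_sum, ← Real.exp_add,
    neg_add_cancel, Real.exp_zero]

include hXmeas hXlaw hXindep in
lemma measureReal_dualCost_ge_le (ht : 0 < t) (s : Fin t → V) (l : V → ℝ) (b : ℝ) :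
    μ.real {ω | b ≤ dualCost l (markovType s, signalType s fun k => X k ω)}
      ≤ Real.exp (t * (-b)) := by
  obtain ⟨hi, h1⟩ := integrable_exp_dualCost hXmeas hXlaw hXindep ht s l
  have h := mul_meas_ge_le_integral_of_nonneg (Eventually.of_forall fun ω => (Real.exp_pos _).le)
    hi (Real.exp (t * b))
  rw [h1] at h
  have hset : {ω | Real.exp (t * b)
      ≤ Real.exp (t * dualCost l (markovType s, signalType s fun k => X k ω))}
      = {ω | b ≤ dualCost l (markovType s, signalType s fun k => X k ω)} := by
    ext ω
    have : (0 : ℝ) < t := by positivity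
    simp only [Set.mem_ofPred_eq, Real.exp_le_exp]
    exact mul_le_mul_iff_right₀ this
  rw [hset] at h
  rw [mul_neg, Real.exp_neg, ← one_div, le_div_iff₀ (Real.exp_pos _), mul_comm]
  exact h

lemma dualCost_update (l : V → ℝ) (i : V) (c : ℝ)
    (x : (V → V → ℝ) × (V → ℝ)) :
    dualCost (l + Pi.single i c) x
      = dualCost l x + (c * x.2 i - rowSum x.1 i * (c * l i + c ^ 2 / 2)) := by
  have h : ∀ j, (l + Pi.single i c : V → ℝ) j * x.2 j
      - rowSum x.1 j * ((l + Pi.single i c : V → ℝ) j ^ 2 / 2)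
      = (l j * x.2 j - rowSum x.1 j * (l j ^ 2 / 2)) +
        if j = i then c * x.2 i - rowSum x.1 i * (c * l i + c ^ 2 / 2) else 0 := by
    intro j
    by_cases hj : j = i
    · subst hj; simp; ring
    · simp [hj]
  rw [dualCost, Finset.sum_congr rfl fun j _ => h j, Finset.sum_add_distrib, ← dualCost]
  simp

lemma rowSum_markovType_le_one (ht : 0 < t) (s : Fin t → V) (i : V) :
    rowSum (markovType s) i ≤ 1 := by
  rw [← sum_markovType_eq_one ht s]
  exact Finset.single_le_sum (f := fun i => ∑ j, markovType s i j)
    (fun i _ => Finset.sum_nonneg fun j _ => markovType_nonneg s i j) (Finset.mem_univ i)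

include hXmeas hXlaw hXindep in
/-- Under the exponential tilt by `l`, the signal type concentrates. -/
lemma integral_exp_dualCost_indicator_le (ht : 0 < t) (s : Fin t → V) (l ξ : V → ℝ) {η : ℝ}
    (hs : ∀ i, |rowSum (markovType s) i * l i - ξ i| ≤ η / 2) (i : V) {σ : ℝ}
    (hσ : σ = 1 ∨ σ = -1) :
    ∫ ω, {ω | η ≤ σ * (signalType s (fun k => X k ω) i - ξ i)}.indicator
      (fun ω => Real.exp (t * dualCost l (markovType s, signalType s fun k => X k ω))) ω ∂μ
      ≤ Real.exp (t * (-(η ^ 2 / 8))) := by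
  have hη : 0 ≤ η := by linarith [abs_nonneg (rowSum (markovType s) i * l i - ξ i), hs i]
  -- A further tilt by `σ η / 2` at `i`. On the event the deviation from the tilted mean `r l i` is
  -- at least `η / 2`, so the exponent gains at least `η² / 4 - r η² / 8 ≥ η² / 8`, where `r ≤ 1` is
  -- the row sum.
  obtain ⟨hi, h1⟩ := integrable_exp_dualCost hXmeas hXlaw hXindep ht s
    (l + Pi.single i (σ * (η / 2)))
  have hle : ∀ ω, {ω | η ≤ σ * (signalType s (fun k => X k ω) i - ξ i)}.indicator
      (fun ω => Real.exp (t * dualCost l (markovType s, signalType s fun k => X k ω))) ω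
      ≤ Real.exp (t * (-(η ^ 2 / 8))) * Real.exp (t * dualCost (l + Pi.single i (σ * (η / 2)))
        (markovType s, signalType s fun k => X k ω)) := by
    intro ω
    by_cases hω : η ≤ σ * (signalType s (fun k => X k ω) i - ξ i)
    swap
    · rw [Set.indicator_of_notMem (show ω ∉ {ω | η ≤ σ * (signalType s (fun k => X k ω) i - ξ i)}
        from hω)]
      positivity
    rw [Set.indicator_of_mem (show ω ∈ {ω | η ≤ σ * (signalType s (fun k => X k ω) i - ξ i)}
      from hω), ← Real.exp_add, ← mul_add, dualCost_update]
    refine Real.exp_le_exp.2 (mul_le_mul_of_nonneg_left ?_ (Nat.cast_nonneg t))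
    simp only
    have h2 := abs_le.1 (hs i)
    have h3 := rowSum_markovType_le_one ht s i
    have h4 := rowSum_nonneg (markovType_nonneg s) i
    set y := signalType s (fun k => X k ω) i
    set r := rowSum (markovType s) i
    have hσ2 : σ ^ 2 = 1 := by rcases hσ with h | h <;> rw [h] <;> norm_num
    have h5 : (σ * (η / 2)) ^ 2 = η ^ 2 / 4 := by rw [mul_pow, hσ2]; ring
    have h6 : η / 2 ≤ σ * y - σ * (r * l i) := by
      rcases hσ with rfl | rfl <;> linarith
    have h7 : η / 2 * (η / 2) ≤ η / 2 * (σ * y - σ * (r * l i)) :=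
      mul_le_mul_of_nonneg_left h6 (by linarith)
    have h8 : r * (η ^ 2 / 4) ≤ η ^ 2 / 4 := mul_le_of_le_one_left (by positivity) h3
    rw [h5]
    nlinarith
  refine (integral_mono_of_nonneg (Eventually.of_forall fun ω =>
    Set.indicator_nonneg (fun ω _ => (Real.exp_pos _).le) ω) (hi.const_mul _)
    (Eventually.of_forall hle)).trans ?_
  rw [integral_const_mul, h1, mul_one]

include hXmeas hXlaw hXindep in
-- The tilted density has integral one. On the event it is at most `exp (t d)`; off it some
-- coordinate is `η`-far from `ξ`, which contributes at most `2 * card V` exponentially small terms.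
lemma exp_mul_le_measureReal_type_mem (ht : 0 < t) (s : Fin t → V) (l ξ : V → ℝ) {η d : ℝ}
    (hs : ∀ i, |rowSum (markovType s) i * l i - ξ i| ≤ η / 2)
    {U : Set ((V → V → ℝ) × (V → ℝ))} (hUm : MeasurableSet U)
    (hU : ∀ z : V → ℝ, (∀ i, |z i - ξ i| < η) → (markovType s, z) ∈ U)
    (hd : ∀ x ∈ U, dualCost l x ≤ d) :
    Real.exp (t * (-d)) * (1 - 2 * Fintype.card V * Real.exp (t * (-(η ^ 2 / 8))))
      ≤ μ.real {ω | (markovType s, signalType s fun k => X k ω) ∈ U} := by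
  obtain ⟨hi, h1⟩ := integrable_exp_dualCost hXmeas hXlaw hXindep ht s l
  set f : Ω → ℝ := fun ω =>
    Real.exp (t * dualCost l (markovType s, signalType s fun k => X k ω)) with hf
  set A := {ω | (markovType s, signalType s fun k => X k ω) ∈ U} with hA
  have hAm : MeasurableSet A := measurable_type hXmeas s hUm
  set B : V → ℝ → Set Ω := fun i σ => {ω | η ≤ σ * (signalType s (fun k => X k ω) i - ξ i)} with hB
  have hBm : ∀ i σ, MeasurableSet (B i σ) := fun i σ =>
    measurableSet_le measurable_const ((((measurable_pi_apply i).comp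
      ((measurable_signalType s).comp (measurable_pi_lambda _ hXmeas))).sub_const _).const_mul _)
  have hpt : ∀ ω, f ω ≤ A.indicator (fun _ => Real.exp (t * d)) ω
      + ∑ i, ((B i 1).indicator f ω + (B i (-1)).indicator f ω) := by
    intro ω
    have hnn : ∀ i σ, 0 ≤ (B i σ).indicator f ω := fun i σ =>
      Set.indicator_nonneg (fun ω _ => (Real.exp_pos _).le) ω
    have hsum : 0 ≤ ∑ i, ((B i 1).indicator f ω + (B i (-1)).indicator f ω) :=
      Finset.sum_nonneg fun i _ => add_nonneg (hnn i 1) (hnn i (-1))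
    by_cases hω : ω ∈ A
    · rw [Set.indicator_of_mem hω]
      have : f ω ≤ Real.exp (t * d) :=
        Real.exp_le_exp.2 (mul_le_mul_of_nonneg_left (hd _ hω) (Nat.cast_nonneg t))
      linarith
    · have hex : ∃ i, η ≤ |signalType s (fun k => X k ω) i - ξ i| := by
        by_contra! h
        exact hω (hU _ h)
      obtain ⟨i, hi⟩ := hex
      rw [Set.indicator_of_notMem hω, zero_add]
      refine le_trans ?_ (Finset.single_le_sum
        (f := fun i => (B i 1).indicator f ω + (B i (-1)).indicator f ω)
        (fun i _ => add_nonneg (hnn i 1) (hnn i (-1))) (Finset.mem_univ i))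
      rcases le_abs.1 hi with h | h
      · have : ω ∈ B i 1 := by simp only [hB, Set.mem_ofPred_eq]; linarith
        simp only [Set.indicator_of_mem this]
        linarith [hnn i (-1)]
      · have : ω ∈ B i (-1) := by simp only [hB, Set.mem_ofPred_eq]; linarith
        simp only [Set.indicator_of_mem this]
        linarith [hnn i 1]
  have hAi : Integrable (A.indicator fun _ => Real.exp (t * d)) μ :=
    (integrable_const _).indicator hAm
  have hBi : ∀ i σ, Integrable ((B i σ).indicator f) μ := fun i σ => hi.indicator (hBm i σ)
  have hCi : ∀ i, Integrable (fun ω => (B i 1).indicator f ω + (B i (-1)).indicator f ω) μ :=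
    fun i => (hBi i 1).add (hBi i (-1))
  have hSi : Integrable (fun ω => ∑ i, ((B i 1).indicator f ω + (B i (-1)).indicator f ω)) μ :=
    integrable_finsetSum _ fun i _ => hCi i
  have hint := integral_mono hi (hAi.add hSi) hpt
  rw [integral_add' hAi hSi, integral_indicator_const _ hAm, h1,
    integral_finsetSum _ fun i _ => hCi i, smul_eq_mul] at hint
  have hbad : ∀ i, ∫ ω, ((B i 1).indicator f ω + (B i (-1)).indicator f ω) ∂μ
      ≤ 2 * Real.exp (t * (-(η ^ 2 / 8))) := by
    intro i
    rw [integral_add (hBi i 1) (hBi i (-1))]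
    have e1 := integral_exp_dualCost_indicator_le hXmeas hXlaw hXindep ht s l ξ hs i (σ := 1)
      (Or.inl rfl)
    have e2 := integral_exp_dualCost_indicator_le hXmeas hXlaw hXindep ht s l ξ hs i (σ := -1)
      (Or.inr rfl)
    linarith
  have hbad' := Finset.sum_le_sum fun i (_ : i ∈ Finset.univ) => hbad i
  rw [Finset.sum_const, Finset.card_univ, nsmul_eq_mul] at hbad'
  have hfin : 1 - 2 * Fintype.card V * Real.exp (t * (-(η ^ 2 / 8)))
      ≤ μ.real A * Real.exp (t * d) := by linarith
  calc _ ≤ Real.exp (t * (-d)) * (μ.real A * Real.exp (t * d)) := by gcongr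
    _ = μ.real A * (Real.exp (t * (-d)) * Real.exp (t * d)) := by ring
    _ = μ.real A := by rw [← Real.exp_add]; simp

end SingleSequence

/-! ### The number of sequences whose type lies in a given set -/

omit [Fintype V] [DecidableEq V] in
lemma ae_eventually_notMem_of_le_exp {Ω : Type*} [MeasurableSpace Ω] {μ : Measure Ω}
    [IsFiniteMeasure μ] {B : ℕ → Set Ω} {M c : ℝ} (hc : 0 < c)
    (h : ∀ᶠ t : ℕ in atTop, μ.real (B t) ≤ M * Real.exp (t * (-c))) :
    ∀ᵐ ω ∂μ, ∀ᶠ t in atTop, ω ∉ B t := by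
  obtain ⟨T, hT⟩ := eventually_atTop.1 h
  have hsum : Summable fun t : ℕ => M * Real.exp (t * (-c)) :=
    (Real.summable_exp_nat_mul_iff.2 (neg_lt_zero.2 hc)).mul_left M
  have hsum' : Summable fun t : ℕ => M * Real.exp ((t + T : ℕ) * (-c)) :=
    (summable_nat_add_iff T).2 hsum
  have hne : ∑' t, μ (B (t + T)) ≠ ⊤ := by
    refine ne_top_of_le_ne_top hsum'.tsum_ofReal_ne_top (ENNReal.tsum_le_tsum fun t => ?_)
    rw [← ofReal_measureReal]
    exact ENNReal.ofReal_le_ofReal (hT _ (Nat.le_add_left _ _))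
  filter_upwards [ae_eventually_notMem hne] with ω hω
  rw [← map_add_atTop_eq_nat T]
  exact eventually_map.2 hω

/-- The number of feasible sequences of length `t` whose Gauss–Markov type lies in `U`. -/
noncomputable def hits (π : V → ℝ) (P : Matrix V V ℝ) (z : NoiseIndex π P → ℝ) (t : ℕ)
    (U : Set ((V → V → ℝ) × (V → ℝ))) : ℝ :=
  ∑ s : feasible π P t,
    U.indicator (fun _ => 1) (markovType s.1, signalType s.1 fun k => z ⟨t, s, k⟩)

section Deterministic

variable {π : V → ℝ} {P : Matrix V V ℝ} {z : NoiseIndex π P → ℝ} {t : ℕ}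
  {U W : Set ((V → V → ℝ) × (V → ℝ))}

lemma hits_nonneg : 0 ≤ hits π P z t U :=
  Finset.sum_nonneg fun _ _ => Set.indicator_nonneg (fun _ _ => zero_le_one) _

lemma hits_mono (h : U ⊆ W) : hits π P z t U ≤ hits π P z t W :=
  Finset.sum_le_sum fun _ _ => Set.indicator_le_indicator_of_subset h (fun _ => zero_le_one) _

lemma one_le_hits {s : feasible π P t}
    (hs : (markovType s.1, signalType s.1 fun k => z ⟨t, s, k⟩) ∈ U) : 1 ≤ hits π P z t U := by
  refine le_trans (le_of_eq ?_) (Finset.single_le_sum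
    (f := fun s : feasible π P t =>
      U.indicator (fun _ => (1 : ℝ)) (markovType s.1, signalType s.1 fun k => z ⟨t, s, k⟩))
    (fun _ _ => Set.indicator_nonneg (fun _ _ => zero_le_one) _) (Finset.mem_univ s))
  rw [Set.indicator_of_mem hs]

lemma hits_eq_zero (h : ∀ s : feasible π P t,
    (markovType s.1, signalType s.1 fun k => z ⟨t, s, k⟩) ∉ U) : hits π P z t U = 0 :=
  Finset.sum_eq_zero fun s _ => Set.indicator_of_notMem (h s) _

/-- Integrality of the count: this turns a mean tending to zero into an empty set of hits, the
source of the cutoff `H ≥ J`. -/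
lemma hits_eq_zero_of_lt_one (h : hits π P z t U < 1) : hits π P z t U = 0 :=
  hits_eq_zero fun _ hs => absurd (one_le_hits hs) (not_le.2 h)

lemma empMeasure_apply (hU : MeasurableSet U) (hC : 0 < (feasible π P t).card) :
    empMeasure π P z t U = ENNReal.ofReal (hits π P z t U / (feasible π P t).card) := by
  have hC' : (0 : ℝ) < (feasible π P t).card := by exact_mod_cast hC
  rw [ENNReal.ofReal_div_of_pos hC', ENNReal.ofReal_natCast, ENNReal.div_eq_inv_mul, empMeasure,
    Measure.smul_apply, smul_eq_mul, Measure.finsetSum_apply, hits, ENNReal.ofReal_sum_of_nonneg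
      fun _ _ => Set.indicator_nonneg (fun _ _ => zero_le_one) _]
  congr 1
  refine Finset.sum_congr rfl fun s _ => ?_
  rw [Measure.dirac_apply' _ hU]
  by_cases h : (markovType s.1, signalType s.1 fun k => z ⟨t, s, k⟩) ∈ U
  · simp [Set.indicator_of_mem h]
  · simp [Set.indicator_of_notMem h]

end Deterministic

/-! ### First-moment upper bounds -/

section Random

variable {P : Matrix V V ℝ} {π : V → ℝ} {Ω : Type*} [MeasurableSpace Ω] {μ : Measure Ω}
  [IsProbabilityMeasure μ] {Z : NoiseIndex π P → Ω → ℝ} (hZmeas : ∀ a, Measurable (Z a))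
  (hZlaw : ∀ a, HasLaw (Z a) (gaussianReal 0 1) μ) (hZindep : iIndepFun Z μ)

/-- The event that the type of the sequence `s` lies in `U`. -/
def typeEvent (Z : NoiseIndex π P → Ω → ℝ) {t : ℕ} (s : feasible π P t)
    (U : Set ((V → V → ℝ) × (V → ℝ))) : Set Ω :=
  {ω | (markovType s.1, signalType s.1 fun k => Z ⟨t, s, k⟩ ω) ∈ U}

include hZmeas in
lemma measurableSet_typeEvent {t : ℕ} (s : feasible π P t) {U : Set ((V → V → ℝ) × (V → ℝ))}
    (hU : MeasurableSet U) : MeasurableSet (typeEvent Z s U) :=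
  measurable_type (fun k => hZmeas ⟨t, s, k⟩) s.1 hU

omit [MeasurableSpace Ω] in
lemma hits_eq_sum_typeEvent (t : ℕ) (U : Set ((V → V → ℝ) × (V → ℝ))) (ω : Ω) :
    hits π P (fun a => Z a ω) t U
      = ∑ s : feasible π P t, (typeEvent Z s U).indicator (fun _ => (1 : ℝ)) ω := rfl

omit [DecidableEq V] [IsProbabilityMeasure μ] in
include hZindep in
lemma iIndepFun_noise {t : ℕ} (s : feasible π P t) :
    iIndepFun (fun k => Z ⟨t, s, k⟩) μ :=
  hZindep.precomp (g := fun k : Fin t => (⟨t, s, k⟩ : NoiseIndex π P)) fun k k' h => by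
    simpa using h

include hZmeas in
lemma integrable_typeEvent {t : ℕ} (s : feasible π P t) {U : Set ((V → V → ℝ) × (V → ℝ))}
    (hU : MeasurableSet U) : Integrable ((typeEvent Z s U).indicator fun _ => (1 : ℝ)) μ :=
  (integrable_const _).indicator (measurableSet_typeEvent hZmeas s hU)

include hZmeas in
lemma integral_hits (t : ℕ) {U : Set ((V → V → ℝ) × (V → ℝ))} (hU : MeasurableSet U) :
    ∫ ω, hits π P (fun a => Z a ω) t U ∂μ = ∑ s : feasible π P t, μ.real (typeEvent Z s U) := by
  simp_rw [hits_eq_sum_typeEvent]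
  rw [integral_finsetSum _ fun s _ => integrable_typeEvent hZmeas s hU]
  refine Finset.sum_congr rfl fun s _ => ?_
  rw [integral_indicator_const _ (measurableSet_typeEvent hZmeas s hU), smul_eq_mul, mul_one]

include hZmeas in
lemma ae_eventually_hits_lt {U : Set ((V → V → ℝ) × (V → ℝ))} (hU : MeasurableSet U)
    {M a κ : ℝ} (haκ : a < κ)
    (h : ∀ᶠ t : ℕ in atTop, ∑ s : feasible π P t, μ.real (typeEvent Z s U)
      ≤ M * Real.exp (t * a)) :
    ∀ᵐ ω ∂μ, ∀ᶠ t : ℕ in atTop, hits π P (fun a => Z a ω) t U < Real.exp (t * κ) := by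
  have hB : ∀ᶠ t : ℕ in atTop, μ.real {ω | Real.exp (t * κ) ≤ hits π P (fun a => Z a ω) t U}
      ≤ M * Real.exp (t * (-(κ - a))) := by
    filter_upwards [h] with t ht
    have hi : Integrable (fun ω => hits π P (fun a => Z a ω) t U) μ := by
      simp_rw [hits_eq_sum_typeEvent]
      exact integrable_finsetSum _ fun s _ => integrable_typeEvent hZmeas s hU
    have hm := mul_meas_ge_le_integral_of_nonneg
      (Eventually.of_forall fun ω => hits_nonneg (z := fun a => Z a ω)) hi (Real.exp (t * κ))
    rw [integral_hits hZmeas t hU] at hm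
    have hm' := hm.trans ht
    rw [mul_comm, ← le_div_iff₀ (Real.exp_pos _)] at hm'
    refine hm'.trans (le_of_eq ?_)
    rw [mul_div_assoc, ← Real.exp_sub]
    ring_nf
  filter_upwards [ae_eventually_notMem_of_le_exp (sub_pos.2 haκ) hB] with ω hω
  filter_upwards [hω] with t ht
  exact not_le.1 ht

include hZmeas hZlaw hZindep in
-- First moment on a neighbourhood that controls both factors: at most `card V * exp (t b)` types
-- fit, each hit with probability at most `exp (-t β)`, and `b - β < κ`. A level `κ ≤ 0` is allowed
-- and means no hits.
lemma exists_isOpen_ae_eventually_hits_lt [Nonempty V] {x : (V → V → ℝ) × (V → ℝ)}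
    (hx : x.1 ∈ typePolytope P) {κ : ℝ}
    (hκ : ((entropy x.1 - κ : ℝ) : EReal) < gaussCost x.1 x.2) :
    ∃ U, IsOpen U ∧ x ∈ U ∧
      ∀ᵐ ω ∂μ, ∀ᶠ t : ℕ in atTop, hits π P (fun a => Z a ω) t U < Real.exp (t * κ) := by
  classical
  obtain ⟨β, hβ, hβJ⟩ := EReal.lt_iff_exists_real_btwn.1 hκ
  rw [EReal.coe_lt_coe_iff] at hβ
  obtain ⟨l, hl⟩ := exists_dualCost_gt hx.2.2.1 hβJ
  obtain ⟨b, hb1, hb2⟩ := exists_between (show entropy x.1 < κ + β by linarith)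
  obtain ⟨Q, hQ, hQ0, hQb⟩ := exists_crossEntropy_lt hx.2.2.1 hx.1 hb1
  have hUo : IsOpen ({y : (V → V → ℝ) × (V → ℝ) | β < dualCost l y} ∩
      {y | -∑ i, ∑ j, y.1 i j * Real.log (Q i j) < b}) :=
    (isOpen_lt continuous_const (continuous_dualCost l)).inter
      (isOpen_lt ((continuous_pairing fun i j => Real.log (Q i j)).comp continuous_fst).neg
        continuous_const)
  refine ⟨_, hUo, ⟨hl, hQb⟩, ?_⟩
  refine ae_eventually_hits_lt hZmeas hUo.measurableSet (M := Fintype.card V) (a := b - β)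
    (by linarith) ?_
  filter_upwards [eventually_gt_atTop 0] with t ht
  set S := Finset.univ.filter fun s : Fin t → V =>
      -∑ i, ∑ j, markovType s i j * Real.log (Q i j) < b with hS
  have hp : ∀ s : feasible π P t, μ.real (typeEvent Z s
      ({y : (V → V → ℝ) × (V → ℝ) | β < dualCost l y} ∩
      {y | -∑ i, ∑ j, y.1 i j * Real.log (Q i j) < b}))
      ≤ if s.1 ∈ S then Real.exp (t * (-β)) else 0 := by
    intro s
    split_ifs with hs
    · refine le_trans (measureReal_mono fun ω hω => ?_) (measureReal_dualCost_ge_le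
        (fun k => hZmeas ⟨t, s, k⟩) (fun k => hZlaw _) (iIndepFun_noise hZindep s) ht s.1 l β)
      exact LT.lt.le (a := β) hω.1
    · refine le_of_eq ?_
      rw [measureReal_eq_zero_iff]
      convert measure_empty (μ := μ)
      refine Set.eq_empty_of_forall_notMem fun ω hω => hs ?_
      exact Finset.mem_filter.2 ⟨Finset.mem_univ _, hω.2⟩
  refine (Finset.sum_le_sum fun s _ => hp s).trans ?_
  rw [Finset.sum_coe_sort (feasible π P t) fun s => if s ∈ S then Real.exp (t * (-β)) else 0,
    ← Finset.sum_filter, Finset.sum_const, nsmul_eq_mul]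
  calc _ ≤ (S.card : ℝ) * Real.exp (t * (-β)) := by
        gcongr
        exact fun s hs => (Finset.mem_filter.1 hs).2
    _ ≤ Fintype.card V * Real.exp (t * b) * Real.exp (t * (-β)) := by
        gcongr
        exact card_crossEntropy_lt_le hQ hQ0 ht b
    _ = _ := by rw [mul_assoc, ← Real.exp_add]; ring_nf

include hZmeas hZlaw hZindep in
lemma exists_isCompact_ae_eventually_hits_eq_zero [Nonempty V]
    (hP : P ∈ Matrix.rowStochastic ℝ V) (hπ : ∀ i, 0 < π i) :
    ∃ K : Set ((V → V → ℝ) × (V → ℝ)), IsCompact K ∧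
      ∀ᵐ ω ∂μ, ∀ᶠ t : ℕ in atTop, hits π P (fun a => Z a ω) t Kᶜ = 0 := by
  set r := Real.log (rho P) with hr
  -- Chosen so that `M² / 2 ≥ r + 2`: the tail `exp (-t M² / 2)` beats the `exp (t (r + 1))`
  -- sequences by a factor `exp (-t)`.
  set M := |r| + 2 with hM
  have hM0 : 0 < M := by positivity
  have hMr : r + 2 ≤ M ^ 2 / 2 := by
    nlinarith [le_abs_self r, abs_nonneg r]
  have hK : IsCompact ((Set.Icc 0 1 : Set (V → V → ℝ)) ×ˢ
      (Set.Icc (fun _ => -M) (fun _ => M) : Set (V → ℝ))) := isCompact_Icc.prod isCompact_Icc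
  refine ⟨_, hK, ?_⟩
  set K := (Set.Icc 0 1 : Set (V → V → ℝ)) ×ˢ
      (Set.Icc (fun _ => -M) (fun _ => M) : Set (V → ℝ)) with hKdef
  have hlt : ∀ᵐ ω ∂μ, ∀ᶠ t : ℕ in atTop,
      hits π P (fun a => Z a ω) t Kᶜ < Real.exp (t * 0) := by
    refine ae_eventually_hits_lt hZmeas hK.measurableSet.compl (M := Fintype.card V * 2)
      (a := -1) (by norm_num) ?_
    filter_upwards [eventually_gt_atTop 0,
      card_feasible_le_exp hP hπ (show Real.log (rho P) < r + 1 by linarith)] with t ht hC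
    have hp : ∀ s : feasible π P t, μ.real (typeEvent Z s Kᶜ)
        ≤ Fintype.card V * 2 * Real.exp (t * (-(M ^ 2 / 2))) := by
      intro s
      set l : V → ℝ → V → ℝ := fun i σ => Pi.single i (σ * M)
      set E : V → ℝ → Set Ω := fun i σ => {ω | M ^ 2 / 2 ≤ dualCost (l i σ)
        (markovType s.1, signalType s.1 fun k => Z ⟨t, s, k⟩ ω)} with hE
      have hEle : ∀ i σ, μ.real (E i σ) ≤ Real.exp (t * (-(M ^ 2 / 2))) := fun i σ =>
        measureReal_dualCost_ge_le (fun k => hZmeas ⟨t, s, k⟩) (fun k => hZlaw _)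
          (iIndepFun_noise hZindep s) ht s.1 (l i σ) _
      have hmem : ∀ i σ, σ = 1 ∨ σ = -1 → ∀ ω,
          M ≤ σ * signalType s.1 (fun k => Z ⟨t, s, k⟩ ω) i → ω ∈ E i σ := by
        intro i σ hσ ω hω
        have h := dualCost_update 0 i (σ * M)
          (markovType s.1, signalType s.1 fun k => Z ⟨t, s, k⟩ ω)
        have h0 : dualCost 0 (markovType s.1, signalType s.1 fun k => Z ⟨t, s, k⟩ ω) = 0 := by
          simp [dualCost]
        rw [zero_add, h0, zero_add] at h
        simp only [hE, l, Set.mem_ofPred_eq, h, Pi.zero_apply, mul_zero, zero_add]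
        have h3 := rowSum_markovType_le_one ht s.1 i
        have hσ2 : (σ * M) ^ 2 = M ^ 2 := by rcases hσ with rfl | rfl <;> ring
        rw [hσ2]
        have h4 := mul_le_mul_of_nonneg_left hω hM0.le
        have h5 : rowSum (markovType s.1) i * (M ^ 2 / 2) ≤ M ^ 2 / 2 :=
          mul_le_of_le_one_left (by positivity) h3
        nlinarith
      have hsub : typeEvent Z s Kᶜ ⊆ ⋃ i, (E i 1 ∪ E i (-1)) := by
        intro ω hω
        by_contra hcon
        simp only [Set.mem_iUnion, Set.mem_union, not_exists, not_or] at hcon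
        refine hω ⟨⟨fun i j => markovType_nonneg s.1 i j, fun i j => markovType_le_one ht s.1 i j⟩,
          fun i => ?_, fun i => ?_⟩
        · by_contra h
          exact (hcon i).2 (hmem i (-1) (Or.inr rfl) ω (by simp only at h ⊢; linarith))
        · by_contra h
          exact (hcon i).1 (hmem i 1 (Or.inl rfl) ω (by simp only at h ⊢; linarith))
      calc μ.real (typeEvent Z s Kᶜ) ≤ μ.real (⋃ i, (E i 1 ∪ E i (-1))) := measureReal_mono hsub
        _ ≤ ∑ i, μ.real (E i 1 ∪ E i (-1)) := measureReal_iUnion_fintype_le _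
        _ ≤ ∑ i : V, 2 * Real.exp (t * (-(M ^ 2 / 2))) := Finset.sum_le_sum fun i _ => by
            linarith [measureReal_union_le (μ := μ) (E i 1) (E i (-1)), hEle i 1, hEle i (-1)]
        _ = _ := by rw [Finset.sum_const, Finset.card_univ, nsmul_eq_mul, mul_assoc]
    refine (Finset.sum_le_sum fun s _ => hp s).trans ?_
    rw [Finset.sum_const, Finset.card_univ, Fintype.card_coe, nsmul_eq_mul]
    calc _ ≤ Real.exp (t * (r + 1)) *
          (Fintype.card V * 2 * Real.exp (t * (-(M ^ 2 / 2)))) := by gcongr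
      _ = Fintype.card V * 2 * Real.exp (t * (r + 1 - M ^ 2 / 2)) := by
          rw [mul_sub, sub_eq_add_neg, Real.exp_add, mul_neg]; ring
      _ ≤ _ := by gcongr; linarith
  filter_upwards [hlt] with ω hω
  filter_upwards [hω] with t ht
  refine hits_eq_zero_of_lt_one ?_
  simpa using ht

end Random

/-! ### Second-moment lower bounds -/

section Random

variable {P : Matrix V V ℝ} {π : V → ℝ} {Ω : Type*} [MeasurableSpace Ω] {μ : Measure Ω}
  [IsProbabilityMeasure μ] {Z : NoiseIndex π P → Ω → ℝ} (hZmeas : ∀ a, Measurable (Z a))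
  (hZlaw : ∀ a, HasLaw (Z a) (gaussianReal 0 1) μ) (hZindep : iIndepFun Z μ)

include hZmeas hZlaw hZindep in
-- By `hl`, the tilt by `l` centres the signal type of a sequence of Markov type `x.1` exactly at
-- `x.2`; for types in `W` the centre moves by less than `η / 2`.
lemma exists_isOpen_exp_mul_le_typeEvent {x : (V → V → ℝ) × (V → ℝ)} {l : V → ℝ}
    (hl : ∀ i, rowSum x.1 i * l i = x.2 i) {U : Set ((V → V → ℝ) × (V → ℝ))} (hU : IsOpen U)
    (hxU : x ∈ U) {d : ℝ} (hd : ∀ y ∈ U, dualCost l y ≤ d) :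
    ∃ W, IsOpen W ∧ x.1 ∈ W ∧ ∃ c > 0, ∀ t > 0, ∀ s : feasible π P t, markovType s.1 ∈ W →
      Real.exp (t * (-d)) * (1 - 2 * Fintype.card V * Real.exp (t * (-c)))
        ≤ μ.real (typeEvent Z s U) := by
  obtain ⟨W₁, W₂, hW₁, hW₂, hx1, hx2, hW⟩ := isOpen_prod_iff.1 hU x.1 x.2 hxU
  obtain ⟨η, hη, hball⟩ := Metric.isOpen_iff.1 hW₂ x.2 hx2
  refine ⟨W₁ ∩ ⋂ i, {θ | |rowSum θ i * l i - x.2 i| < η / 2}, hW₁.inter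
    (isOpen_iInter_of_finite fun i => ?_), ⟨hx1, ?_⟩, η ^ 2 / 8, by positivity,
    fun t ht s hs => ?_⟩
  · exact isOpen_lt ((((continuous_rowSum i).mul continuous_const).sub continuous_const).abs)
      continuous_const
  · refine Set.mem_iInter.2 fun i => ?_
    simp only [Set.mem_ofPred_eq, hl i, sub_self, abs_zero]
    positivity
  · have hs2 : ∀ i, |rowSum (markovType s.1) i * l i - x.2 i| ≤ η / 2 := fun i =>
      LT.lt.le (b := η / 2) (Set.mem_iInter.1 hs.2 i)
    refine exp_mul_le_measureReal_type_mem (fun k => hZmeas ⟨t, s, k⟩) (fun k => hZlaw _)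
      (iIndepFun_noise hZindep s) ht s.1 l x.2 hs2 hU.measurableSet (fun z hz => ?_) hd
    refine hW ⟨hs.1, hball ?_⟩
    rw [Metric.mem_ball, dist_pi_lt_iff hη]
    exact fun i => by rw [Real.dist_eq]; exact hz i

omit [IsProbabilityMeasure μ] in
include hZmeas hZindep in
lemma indepFun_typeEvent {t : ℕ} {s s' : feasible π P t} (hss : s ≠ s')
    {U : Set ((V → V → ℝ) × (V → ℝ))} (hU : MeasurableSet U) :
    IndepFun ((typeEvent Z s U).indicator fun _ => (1 : ℝ))
      ((typeEvent Z s' U).indicator fun _ => (1 : ℝ)) μ := by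
  classical
  let B : feasible π P t → Finset (NoiseIndex π P) := fun s =>
    Finset.univ.image fun k : Fin t => (⟨t, s, k⟩ : NoiseIndex π P)
  have hB : ∀ s k, (⟨t, s, k⟩ : NoiseIndex π P) ∈ B s := fun s k =>
    Finset.mem_image_of_mem _ (Finset.mem_univ k)
  have hdisj : Disjoint (B s) (B s') := by
    rw [Finset.disjoint_left]
    intro a ha ha'
    obtain ⟨k, -, rfl⟩ := Finset.mem_image.1 ha
    obtain ⟨k', -, h⟩ := Finset.mem_image.1 ha'
    simp only [Sigma.mk.injEq, heq_eq_eq, Prod.mk.injEq, true_and] at h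
    exact hss h.1.symm
  let g : (s : feasible π P t) → (B s → ℝ) → ℝ := fun s z =>
    U.indicator (fun _ => (1 : ℝ)) (markovType s.1, signalType s.1 fun k => z ⟨⟨t, s, k⟩, hB s k⟩)
  have hg : ∀ s, Measurable (g s) := fun s =>
    (measurable_const.indicator hU).comp (measurable_const.prodMk
      ((measurable_signalType s.1).comp
        (measurable_pi_lambda _ fun k => measurable_pi_apply _)))
  exact (hZindep.indepFun_finset (B s) (B s') hdisj hZmeas).comp (hg s) (hg s')

include hZmeas hZindep in
/-- Chebyshev's inequality for the number of sequences with type in `U`. -/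
lemma measureReal_hits_le_half (t : ℕ) {U : Set ((V → V → ℝ) × (V → ℝ))} (hU : MeasurableSet U)
    {m : ℝ} (hm : m = ∑ s : feasible π P t, μ.real (typeEvent Z s U)) (hm0 : 0 < m) :
    μ.real {ω | hits π P (fun a => Z a ω) t U ≤ m / 2} ≤ 4 / m := by
  set Y : feasible π P t → Ω → ℝ := fun s => (typeEvent Z s U).indicator fun _ => (1 : ℝ)
  have hYm : ∀ s, MemLp (Y s) 2 μ := fun s =>
    (memLp_const 1).indicator (measurableSet_typeEvent hZmeas s hU)
  have hhits : (fun ω => hits π P (fun a => Z a ω) t U) = ∑ s, Y s := by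
    funext ω
    rw [hits_eq_sum_typeEvent, Finset.sum_apply]
  have hmean : ∫ ω, (∑ s, Y s) ω ∂μ = m := by
    rw [hm, ← integral_hits hZmeas t hU, ← hhits]
  have hvar : variance (∑ s, Y s) μ ≤ m := by
    -- Distinct sequences read disjoint blocks of noise, so the variance is a sum over sequences,
    -- and for an indicator the variance is at most the mean.
    rw [IndepFun.variance_sum (fun s _ => hYm s)
      (fun s _ s' _ hss => indepFun_typeEvent hZmeas hZindep hss hU), hm]
    refine Finset.sum_le_sum fun s _ => ?_
    refine (variance_le_expectation_sq (hYm s).aestronglyMeasurable).trans (le_of_eq ?_)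
    have : Y s ^ 2 = Y s := by
      funext ω
      by_cases h : ω ∈ typeEvent Z s U <;> simp [Y, h]
    rw [this, integral_indicator_const _ (measurableSet_typeEvent hZmeas s hU), smul_eq_mul,
      mul_one]
  have hcheb := meas_ge_le_variance_div_sq (μ := μ) (memLp_finsetSum' Finset.univ
    fun s _ => hYm s) (half_pos hm0)
  rw [hmean] at hcheb
  have hsub : {ω | hits π P (fun a => Z a ω) t U ≤ m / 2} ⊆ {ω | m / 2 ≤ |(∑ s, Y s) ω - m|} := by
    intro ω hω
    have h1 : (∑ s, Y s) ω ≤ m / 2 := by rw [← hhits]; exact hω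
    refine le_trans ?_ (neg_le_abs ((∑ s, Y s) ω - m))
    linarith
  calc μ.real {ω | hits π P (fun a => Z a ω) t U ≤ m / 2}
      ≤ μ.real {ω | m / 2 ≤ |(∑ s, Y s) ω - m|} := measureReal_mono hsub
    _ ≤ variance (∑ s, Y s) μ / (m / 2) ^ 2 :=
        ENNReal.toReal_le_of_le_ofReal (div_nonneg (variance_nonneg _ _) (sq_nonneg _)) hcheb
    _ ≤ m / (m / 2) ^ 2 := by gcongr
    _ = 4 / m := by field_simp; norm_num

variable (hP : P ∈ Matrix.rowStochastic ℝ V) (hirr : P.IsIrreducible) (hπ : ∀ i, 0 < π i)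

include hZmeas hZlaw hZindep hP hirr hπ in
-- The mean exceeds `exp (t (a - d)) / 2` with `a - d > κ`. Positivity of `κ` makes Chebyshev's
-- bound `8 * exp (-t (a - d))` summable.
lemma ae_eventually_exp_le_hits {x : (V → V → ℝ) × (V → ℝ)} (hx : HasFullSupport P x.1)
    {l : V → ℝ} (hl : ∀ i, rowSum x.1 i * l i = x.2 i) {κ : ℝ} (hκ0 : 0 < κ)
    (hκ : κ < entropy x.1 - dualCost l x) {U : Set ((V → V → ℝ) × (V → ℝ))} (hU : IsOpen U)
    (hxU : x ∈ U) :
    ∀ᵐ ω ∂μ, ∀ᶠ t : ℕ in atTop, Real.exp (t * κ) ≤ hits π P (fun a => Z a ω) t U := by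
  classical
  obtain ⟨d, hd1, hd2⟩ := exists_between (show dualCost l x < entropy x.1 - κ by linarith)
  obtain ⟨a, ha1, ha2⟩ := exists_between (show κ + d < entropy x.1 by linarith)
  have hU' : IsOpen (U ∩ {y | dualCost l y < d}) :=
    hU.inter (isOpen_lt (continuous_dualCost l) continuous_const)
  set U' := U ∩ {y | dualCost l y < d}
  obtain ⟨W, hW, hxW, c, hc, hWp⟩ := exists_isOpen_exp_mul_le_typeEvent hZmeas hZlaw hZindep hl hU'
    ⟨hxU, hd1⟩ fun y hy => le_of_lt hy.2
  have hmean : ∀ᶠ t : ℕ in atTop, 1 / 2 * Real.exp (t * (a - d))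
      ≤ ∑ s : feasible π P t, μ.real (typeEvent Z s U') := by
    filter_upwards [exp_le_card_markovType_mem hP hirr hπ hx hW hxW ha2,
      eventually_const_mul_exp_le (4 * Fintype.card V : ℝ) (neg_lt_zero.2 hc),
      eventually_gt_atTop 0] with t ht hexp ht0
    have hhalf : 1 / 2 ≤ 1 - 2 * Fintype.card V * Real.exp (t * (-c)) := by
      rw [mul_zero, Real.exp_zero] at hexp
      linarith
    have hp : ∀ s : feasible π P t, (if markovType s.1 ∈ W then 1 / 2 * Real.exp (t * (-d)) else 0)
        ≤ μ.real (typeEvent Z s U') := by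
      intro s
      split_ifs with hs
      · refine le_trans ?_ (hWp t ht0 s hs)
        rw [mul_comm]
        gcongr
      · exact measureReal_nonneg
    refine le_trans ?_ (Finset.sum_le_sum fun s _ => hp s)
    rw [Finset.sum_coe_sort (feasible π P t) fun s =>
      if markovType s ∈ W then 1 / 2 * Real.exp (t * (-d)) else 0,
      ← Finset.sum_filter, Finset.sum_const, nsmul_eq_mul]
    calc 1 / 2 * Real.exp (t * (a - d)) = Real.exp (t * a) * (1 / 2 * Real.exp (t * (-d))) := by
          rw [mul_sub, sub_eq_add_neg, Real.exp_add, mul_neg]; ring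
      _ ≤ _ := by gcongr
  have hB : ∀ᶠ t : ℕ in atTop, μ.real {ω | hits π P (fun a => Z a ω) t U'
      ≤ (∑ s : feasible π P t, μ.real (typeEvent Z s U')) / 2}
      ≤ 8 * Real.exp (t * (-(a - d))) := by
    filter_upwards [hmean] with t ht
    have hpos : 0 < 1 / 2 * Real.exp (t * (a - d)) := by positivity
    refine (measureReal_hits_le_half hZmeas hZindep t hU'.measurableSet rfl
      (hpos.trans_le ht)).trans ?_
    calc _ ≤ 4 / (1 / 2 * Real.exp (t * (a - d))) := by gcongr
      _ = _ := by rw [mul_neg, Real.exp_neg]; field_simp; norm_num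
  filter_upwards [ae_eventually_notMem_of_le_exp (show 0 < a - d by linarith) hB] with ω hω
  filter_upwards [hω, hmean, eventually_const_mul_exp_le 4 (show κ < a - d by linarith)]
    with t h1 h2 h3
  have h1 := not_le.1 h1
  have := hits_mono (π := π) (P := P) (z := fun a => Z a ω) (t := t)
    (Set.inter_subset_left : U' ⊆ U)
  linarith

include hZmeas hZlaw hZindep hP hirr hπ in
-- Replaces the second moment when the entropy may vanish. At `ξ = 0` no tilt is needed: any single
-- sequence with type near `θ` already hits `U` except with exponentially small probability.
lemma ae_eventually_one_le_hits {θ : V → V → ℝ} (hθ : HasFullSupport P θ)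
    {U : Set ((V → V → ℝ) × (V → ℝ))} (hU : IsOpen U) (hxU : (θ, 0) ∈ U) :
    ∀ᵐ ω ∂μ, ∀ᶠ t : ℕ in atTop, 1 ≤ hits π P (fun a => Z a ω) t U := by
  classical
  obtain ⟨W, hW, hxW, c, hc, hWp⟩ := exists_isOpen_exp_mul_le_typeEvent hZmeas hZlaw hZindep
    (x := (θ, 0)) (l := 0) (by simp) hU hxU (d := 0) (by simp [dualCost])
  have hB : ∀ᶠ t : ℕ in atTop, μ.real {ω | hits π P (fun a => Z a ω) t U < 1}
      ≤ 2 * Fintype.card V * Real.exp (t * (-c)) := by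
    filter_upwards [exp_le_card_markovType_mem hP hirr hπ hθ hW hxW (sub_one_lt (entropy θ)),
      eventually_gt_atTop 0] with t ht ht0
    have hpos := (Real.exp_pos _).trans_le ht
    rw [Nat.cast_pos, Finset.card_pos] at hpos
    obtain ⟨s, hs⟩ := hpos
    obtain ⟨hs1, hs2⟩ := Finset.mem_filter.1 hs
    have h := hWp t ht0 ⟨s, hs1⟩ hs2
    rw [neg_zero, mul_zero, Real.exp_zero, one_mul] at h
    have hsub : {ω | hits π P (fun a => Z a ω) t U < 1} ⊆ (typeEvent Z ⟨s, hs1⟩ U)ᶜ :=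
      fun ω hω hmem => absurd (one_le_hits hmem) (not_le.2 hω)
    refine (measureReal_mono hsub).trans ?_
    rw [probReal_compl_eq_one_sub (measurableSet_typeEvent hZmeas _ hU.measurableSet)]
    linarith
  filter_upwards [ae_eventually_notMem_of_le_exp hc hB] with ω hω
  filter_upwards [hω] with t ht
  exact not_lt.1 ht

end Random

/-! ### Approximation by types with full support -/

section Approximation

variable {P : Matrix V V ℝ} {θ η : V → V → ℝ}

omit [Fintype V] [DecidableEq V] in
lemma tendsto_mix (θ η : V → V → ℝ) :
    Tendsto (fun ε : ℝ => (1 - ε) • θ + ε • η) (nhdsWithin 0 (Set.Ioi 0)) (nhds θ) := by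
  have h : Continuous fun ε : ℝ => (1 - ε) • θ + ε • η := by fun_prop
  have h0 := h.tendsto 0
  simp only [sub_zero, one_smul, zero_smul, add_zero] at h0
  exact h0.mono_left nhdsWithin_le_nhds

lemma eventually_Ioo_zero_one : ∀ᶠ ε : ℝ in nhdsWithin 0 (Set.Ioi 0), 0 < ε ∧ ε < 1 :=
  Ioo_mem_nhdsGT zero_lt_one

omit [DecidableEq V] in
lemma eventually_hasFullSupport_mix (hθ : θ ∈ typePolytope P) (hη : HasFullSupport P η) :
    ∀ᶠ ε : ℝ in nhdsWithin 0 (Set.Ioi 0), HasFullSupport P ((1 - ε) • θ + ε • η) := by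
  filter_upwards [eventually_Ioo_zero_one] with ε hε
  exact HasFullSupport.convexCombo hθ hη (by linarith) hε.1 (by ring)

omit [DecidableEq V] in
lemma tendsto_entropy_mix (hθ : θ ∈ typePolytope P) (hη : HasFullSupport P η) :
    Tendsto (fun ε : ℝ => entropy ((1 - ε) • θ + ε • η)) (nhdsWithin 0 (Set.Ioi 0))
      (nhds (entropy θ)) := by
  refine (continuousOn_entropy θ hθ.2.2.1).tendsto.comp
    (tendsto_nhdsWithin_iff.2 ⟨tendsto_mix θ η, ?_⟩)
  filter_upwards [eventually_hasFullSupport_mix hθ hη] with ε hε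
  exact hε.1.2.2.1

omit [DecidableEq V] in
lemma rowSum_le_one (hθ : θ ∈ typePolytope P) (i : V) : rowSum θ i ≤ 1 := by
  rw [← hθ.1]
  exact Finset.single_le_sum (f := fun i => ∑ j, θ i j)
    (fun i _ => Finset.sum_nonneg fun j _ => hθ.2.2.1 i j) (Finset.mem_univ i)

lemma eq_zero_of_gaussCost_le_zero {x : (V → V → ℝ) × (V → ℝ)} (hx : x.1 ∈ typePolytope P)
    (h : gaussCost x.1 x.2 ≤ 0) : x.2 = 0 := by
  funext i
  have h1 := (dualCost_le_gaussCost (0 + Pi.single i (x.2 i)) hx.2.2.1).trans h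
  have h0 : dualCost (0 : V → ℝ) x = 0 := by simp [dualCost]
  rw [← EReal.coe_zero, EReal.coe_le_coe_iff, dualCost_update, h0] at h1
  have h2 := mul_le_mul_of_nonneg_right (rowSum_le_one hx i) (sq_nonneg (x.2 i))
  simp only [Pi.zero_apply] at h1 ⊢
  have h3 : x.2 i ^ 2 ≤ 0 := by nlinarith
  exact pow_eq_zero_iff two_ne_zero |>.1 (h3.antisymm (sq_nonneg _))

omit [DecidableEq V] in
-- Rescaling `l` by `(1 - ε) / a` compares with the cost at `x`; the mass added by `η` only lowers
-- `dualCost`. Uniformity in `l` allows the optimal tilt of the mixed point to be inserted later.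
lemma dualCost_mix_le (hη : ∀ i j, 0 ≤ η i j) {x : (V → V → ℝ) × (V → ℝ)}
    (hx : ∀ i j, 0 ≤ x.1 i j) {c : ℝ} (hc : gaussCost x.1 x.2 = c) (l : V → ℝ) {a ε : ℝ}
    (ha : a ≠ 0) (hε0 : 0 < ε) (hε1 : ε < 1) :
    dualCost l ((1 - ε) • x.1 + ε • η, a • x.2) ≤ a ^ 2 / (1 - ε) * c := by
  have he : 0 < 1 - ε := by linarith
  have h := dualCost_le_gaussCost (fun i => (1 - ε) / a * l i) hx
  rw [hc, EReal.coe_le_coe_iff] at h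
  refine le_trans ?_ (mul_le_mul_of_nonneg_left h (by positivity))
  rw [dualCost, dualCost, Finset.mul_sum]
  refine Finset.sum_le_sum fun i _ => ?_
  have hr : rowSum ((1 - ε) • x.1 + ε • η) i = (1 - ε) * rowSum x.1 i + ε * rowSum η i := by
    simp only [rowSum, Pi.add_apply, Pi.smul_apply, smul_eq_mul, Finset.sum_add_distrib,
      Finset.mul_sum]
  have h2 : 0 ≤ ε * rowSum η i * (l i ^ 2 / 2) :=
    mul_nonneg (mul_nonneg hε0.le (rowSum_nonneg hη i)) (by positivity)
  simp only [hr, Pi.smul_apply, smul_eq_mul]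
  have h3 : a ^ 2 / (1 - ε) * ((1 - ε) / a * l i * x.2 i
      - rowSum x.1 i * (((1 - ε) / a * l i) ^ 2 / 2))
      = l i * (a * x.2 i) - (1 - ε) * rowSum x.1 i * (l i ^ 2 / 2) := by
    field_simp
  rw [h3]
  linarith

/-- There cannot be more sequences of a given type than feasible sequences. This makes the rate
nonnegative; mixing with `π i * P i j` extends the bound from full support to the whole polytope. -/
lemma entropy_le_log_rho (hP : P ∈ Matrix.rowStochastic ℝ V) (hirr : P.IsIrreducible)
    {π : V → ℝ} (hπ : IsStationary π P) [Nonempty V] (hθ : θ ∈ typePolytope P) :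
    entropy θ ≤ Real.log (rho P) := by
  classical
  have hfull : ∀ η, HasFullSupport P η → entropy η ≤ Real.log (rho P) := by
    intro η hη
    by_contra! hlt
    obtain ⟨b, hb1, hb2⟩ := exists_between hlt
    obtain ⟨a, hab, ha⟩ := exists_between hb2
    obtain ⟨U, hU, hηU⟩ : ∃ U, IsOpen U ∧ η ∈ U := ⟨Set.univ, isOpen_univ, Set.mem_univ η⟩
    obtain ⟨t, h1, h2, ht⟩ := ((exp_le_card_markovType_mem hP hirr (hπ.pos hirr) hη hU
      hηU ha).and ((card_feasible_le_exp hP (hπ.pos hirr) hb1).and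
        (eventually_gt_atTop 0))).exists
    have h3 : Real.exp (t * a) ≤ Real.exp (t * b) := by
      refine (h1.trans ?_).trans h2
      exact_mod_cast Finset.card_filter_le _ _
    rw [Real.exp_le_exp, mul_le_mul_iff_right₀ (by positivity)] at h3
    exact absurd h3 (not_le.2 hab)
  refine le_of_tendsto (tendsto_entropy_mix hθ (hπ.hasFullSupport hP hirr)) ?_
  filter_upwards [eventually_hasFullSupport_mix hθ (hπ.hasFullSupport hP hirr)] with ε hε
  exact hfull _ hε

lemma isRateFunction_rate (hP : P ∈ Matrix.rowStochastic ℝ V) (hirr : P.IsIrreducible)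
    {π : V → ℝ} (hπ : IsStationary π P) [Nonempty V] : IsRateFunction (rate P) := by
  refine ⟨lowerSemicontinuous_rate P, fun x => ?_⟩
  by_contra! h
  obtain ⟨a, ha1, ha2⟩ := EReal.lt_iff_exists_real_btwn.1 h
  refine absurd (lt_rate_iff.2 fun hx => ?_) (not_lt.2 ha1.le)
  refine lt_of_lt_of_le ?_ (gaussCost_nonneg hx.2.2.1)
  have ha : a < 0 := by exact_mod_cast ha2
  have h1 := entropy_le_log_rho hP hirr hπ hx
  have h2 := min_le_right 0 (a - Real.log (rho P))
  rw [← EReal.coe_zero, EReal.coe_lt_coe_iff]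
  linarith

lemma exists_of_rate_lt {x : (V → V → ℝ) × (V → ℝ)} {a : ℝ} (h : rate P x < a) :
    x.1 ∈ typePolytope P ∧ ∃ c : ℝ, gaussCost x.1 x.2 = c ∧ 0 ≤ c ∧ c ≤ entropy x.1 ∧
      Real.log (rho P) - entropy x.1 + c < a := by
  rw [rate] at h
  split_ifs at h with hx
  · refine ⟨hx.1, ?_⟩
    have h0 := gaussCost_nonneg hx.1.2.2.1
    have h1 := hx.2
    induction hJ : gaussCost x.1 x.2 with
    | bot => simp [hJ] at h0
    | top => simp [hJ] at h1
    | coe c =>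
      rw [hJ] at h h0 h1
      exact ⟨c, rfl, by exact_mod_cast h0, by exact_mod_cast h1, by exact_mod_cast h⟩
  · exact absurd h (not_lt.2 le_top)

end Approximation

/-! ### The local large deviations bounds -/

section Local

variable {P : Matrix V V ℝ} {π : V → ℝ} {Ω : Type*} [MeasurableSpace Ω] {μ : Measure Ω}
  [IsProbabilityMeasure μ] {Z : NoiseIndex π P → Ω → ℝ} (hZmeas : ∀ a, Measurable (Z a))
  (hZlaw : ∀ a, HasLaw (Z a) (gaussianReal 0 1) μ) (hZindep : iIndepFun Z μ)
  (hP : P ∈ Matrix.rowStochastic ℝ V) (hirr : P.IsIrreducible) (hπ : IsStationary π P)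

include hZmeas hZlaw hZindep hP hirr hπ in
lemma exists_isOpen_ae_empMeasure_le [Nonempty V] (x : (V → V → ℝ) × (V → ℝ)) (α : ℝ)
    (hα : (α : EReal) < rate P x) : ∃ U, IsOpen U ∧ x ∈ U ∧ ∀ᵐ ω ∂μ, ∀ᶠ t : ℕ in atTop,
      empMeasure π P (fun a => Z a ω) t U ≤ ENNReal.ofReal (Real.exp (t * (-α))) := by
  have hπ0 := hπ.pos hirr
  have hzero : ∀ {U : Set ((V → V → ℝ) × (V → ℝ))} {t : ℕ} {z : NoiseIndex π P → ℝ}, IsOpen U →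
      0 < t → hits π P z t U = 0 →
      empMeasure π P z t U ≤ ENNReal.ofReal (Real.exp (t * (-α))) := by
    intro U t z hU ht h
    rw [empMeasure_apply hU.measurableSet (card_feasible_pos hP hπ0 ht), h]
    simp
  by_cases hx : x.1 ∈ typePolytope P
  swap
  · obtain ⟨U, hU, hxU, h⟩ := exists_isOpen_forall_markovType_notMem hirr.nonneg hπ0 hx
    refine ⟨U ×ˢ Set.univ, hU.prod isOpen_univ, ⟨hxU, Set.mem_univ _⟩,
      Eventually.of_forall fun ω => ?_⟩
    filter_upwards [h, eventually_gt_atTop 0] with t ht ht0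
    exact hzero (hU.prod isOpen_univ) ht0 (hits_eq_zero fun s hs => ht s.1 s.2 hs.1)
  obtain ⟨K, hK1, hK2⟩ := EReal.lt_iff_exists_real_btwn.1 (lt_rate_iff.1 hα hx)
  rw [EReal.coe_lt_coe_iff] at hK1
  obtain ⟨U, hU, hxU, h⟩ := exists_isOpen_ae_eventually_hits_lt hZmeas hZlaw hZindep hx
    (κ := entropy x.1 - K) (by rwa [sub_sub_cancel])
  refine ⟨U, hU, hxU, ?_⟩
  filter_upwards [h] with ω hω
  -- For `α ≥ log ρ₀` there must be no hits at all; otherwise a bound on the count is compared with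
  -- the number of feasible sequences.
  rcases le_total 0 (α - Real.log (rho P)) with h0 | h0
  · rw [min_eq_left h0] at hK1
    filter_upwards [hω, eventually_gt_atTop 0] with t ht ht0
    refine hzero hU ht0 (hits_eq_zero_of_lt_one (ht.trans_le ?_))
    rw [Real.exp_le_one_iff]
    exact mul_nonpos_of_nonneg_of_nonpos (Nat.cast_nonneg t) (by linarith)
  · rw [min_eq_right h0] at hK1
    filter_upwards [hω, eventually_gt_atTop 0, exp_le_card_feasible hP hπ0
      (show entropy x.1 - K + α < Real.log (rho P) by linarith)] with t ht ht0 hC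
    rw [empMeasure_apply hU.measurableSet (card_feasible_pos hP hπ0 ht0)]
    refine ENNReal.ofReal_le_ofReal ?_
    calc _ ≤ Real.exp (t * (entropy x.1 - K)) / Real.exp (t * (entropy x.1 - K + α)) := by gcongr
      _ = _ := by rw [← Real.exp_sub]; ring_nf

include hZmeas hZlaw hZindep hP hirr hπ in
lemma ae_eventually_le_empMeasure [Nonempty V] (x : (V → V → ℝ) × (V → ℝ)) (α : ℝ)
    (hα : rate P x < (α : EReal)) (U : Set ((V → V → ℝ) × (V → ℝ))) (hU : IsOpen U)
    (hxU : x ∈ U) : ∀ᵐ ω ∂μ, ∀ᶠ t : ℕ in atTop,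
      ENNReal.ofReal (Real.exp (t * (-α))) ≤ empMeasure π P (fun a => Z a ω) t U := by
  have hπ0 := hπ.pos hirr
  have hη := hπ.hasFullSupport hP hirr
  obtain ⟨hx, c, hc, hc0, hcH, hα'⟩ := exists_of_rate_lt hα
  suffices h : ∃ κ : ℝ, Real.log (rho P) < κ + α ∧
      ∀ᵐ ω ∂μ, ∀ᶠ t : ℕ in atTop, Real.exp (t * κ) ≤ hits π P (fun a => Z a ω) t U by
    obtain ⟨κ, hκ, h⟩ := h
    filter_upwards [h] with ω hω
    filter_upwards [hω, card_feasible_le_exp hP hπ0 hκ, eventually_gt_atTop 0] with t ht hC ht0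
    have hpos := card_feasible_pos hP hπ0 ht0
    rw [empMeasure_apply hU.measurableSet hpos]
    refine ENNReal.ofReal_le_ofReal ?_
    have hpos' : (0 : ℝ) < (feasible π P t).card := by exact_mod_cast hpos
    have hnn := hits_nonneg (π := π) (P := P) (z := fun a => Z a ω) (t := t) (U := U)
    calc Real.exp (t * (-α)) = Real.exp (t * κ) / Real.exp (t * (κ + α)) := by
          rw [← Real.exp_sub]; ring_nf
      _ ≤ _ := by gcongr
  -- If the entropy vanishes then so does the cost, hence `ξ = 0` and one hit suffices, since `α >
  -- log ρ₀`.
  rcases (hc0.trans hcH).eq_or_lt with hH | hH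
  · have hx2 : x.2 = 0 := by
      refine eq_zero_of_gaussCost_le_zero hx ?_
      rw [hc]
      exact_mod_cast hcH.trans hH.ge
    have hlim : Tendsto (fun ε : ℝ => ((1 - ε) • x.1 + ε • fun i j => π i * P i j, (0 : V → ℝ)))
        (nhdsWithin 0 (Set.Ioi 0)) (nhds x) := by
      have := (tendsto_mix x.1 fun i j => π i * P i j).prodMk_nhds
        (tendsto_const_nhds (x := (0 : V → ℝ)))
      rwa [← hx2] at this ⊢
    obtain ⟨ε, hε1, hε2⟩ := ((hlim.eventually (hU.mem_nhds hxU)).and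
      (eventually_hasFullSupport_mix hx hη)).exists
    refine ⟨0, by linarith, ?_⟩
    filter_upwards [ae_eventually_one_le_hits hZmeas hZlaw hZindep hP hirr hπ0 hε2 hU hε1]
      with ω hω
    filter_upwards [hω] with t ht
    simpa using ht
  -- Shrinking `ξ` first makes the cost strictly smaller than the entropy, even when they were
  -- equal; the slack pays for the later mixing of `θ`.
  · have hlim : Tendsto (fun ε : ℝ => (x.1, (1 - ε) • x.2)) (nhdsWithin 0 (Set.Ioi 0)) (nhds x) := by
      have h : Continuous fun ε : ℝ => (x.1, (1 - ε) • x.2) := by fun_prop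
      have h0 := h.tendsto 0
      simp only [sub_zero, one_smul] at h0
      exact h0.mono_left nhdsWithin_le_nhds
    obtain ⟨δ, hδU, hδ0, hδ1⟩ := ((hlim.eventually (hU.mem_nhds hxU)).and
      eventually_Ioo_zero_one).exists
    set a := 1 - δ with ha
    have ha0 : 0 < a := by linarith
    have ha2 : a ^ 2 * c ≤ a * c := by
      refine mul_le_mul_of_nonneg_right ?_ hc0
      nlinarith
    have hgap : a ^ 2 * c < entropy x.1 ∧ Real.log (rho P) - α < entropy x.1 - a ^ 2 * c := by
      have h1 : a * c ≤ c := mul_le_of_le_one_left hc0 (by linarith)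
      refine ⟨?_, by linarith⟩
      rcases hc0.eq_or_lt with h | h
      · rw [← h, mul_zero]; exact hH
      · have : a * c < c := mul_lt_of_lt_one_left h (by linarith)
        linarith
    obtain ⟨κ, hκ1, hκ2⟩ := exists_between
      (max_lt (show 0 < entropy x.1 - a ^ 2 * c by linarith [hgap.1]) hgap.2)
    rw [max_lt_iff] at hκ1
    refine ⟨κ, by linarith [hκ1.2], ?_⟩
    have hlim2 : Tendsto (fun ε : ℝ => ((1 - ε) • x.1 + ε • fun i j => π i * P i j, a • x.2))
        (nhdsWithin 0 (Set.Ioi 0)) (nhds (x.1, a • x.2)) :=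
      (tendsto_mix x.1 fun i j => π i * P i j).prodMk_nhds tendsto_const_nhds
    have hlim3 : Tendsto (fun ε : ℝ => a ^ 2 / (1 - ε) * c) (nhdsWithin 0 (Set.Ioi 0))
        (nhds (a ^ 2 * c)) := by
      have h : ContinuousAt (fun ε : ℝ => a ^ 2 / (1 - ε) * c) 0 := by
        refine (continuousAt_const.div (continuousAt_const.sub continuousAt_id) ?_).mul
          continuousAt_const
        simp
      have h0 := h.tendsto
      simp only [sub_zero, div_one] at h0
      exact h0.mono_left nhdsWithin_le_nhds
    -- A small `ε` gives full support while the entropy and the cost bound `a² c / (1 - ε)` stay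
    -- close to their limits, so their difference still exceeds `κ`.
    obtain ⟨ε, hεU, hεf, hεκ, hε0, hε1⟩ := ((hlim2.eventually (hU.mem_nhds hδU)).and
      ((eventually_hasFullSupport_mix hx hη).and
      ((((tendsto_entropy_mix hx hη).sub hlim3).eventually_const_lt hκ2).and
      eventually_Ioo_zero_one))).exists
    set θ' := (1 - ε) • x.1 + ε • fun i j => π i * P i j
    refine ae_eventually_exp_le_hits hZmeas hZlaw hZindep hP hirr hπ0 (x := (θ', a • x.2)) hεf
      (l := fun i => (a • x.2) i / rowSum θ' i)
      (fun i => mul_div_cancel₀ _ (hεf.rowSum_pos hP i).ne') hκ1.1 ?_ hU hεU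
    have := dualCost_mix_le hη.1.2.2.1 hx.2.2.1 hc (fun i => (a • x.2) i / rowSum θ' i)
      ha0.ne' hε0 hε1
    simp only at hεκ ⊢
    linarith

end Local

end GaussMarkov

theorem mainTheorem2 {V : Type*} [Fintype V] [DecidableEq V]
    (P : Matrix V V ℝ) (hP : P ∈ Matrix.rowStochastic ℝ V)
    (hirr : P.IsIrreducible) (haper : GaussMarkov.IsAperiodic P)
    (π : V → ℝ) (hπ : GaussMarkov.IsStationary π P)
    {Ω : Type*} [MeasurableSpace Ω] (μ : Measure Ω) [IsProbabilityMeasure μ]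
    (Z : GaussMarkov.NoiseIndex π P → Ω → ℝ)
    (hZmeas : ∀ a, Measurable (Z a))
    (hZlaw : ∀ a, HasLaw (Z a) (gaussianReal 0 1) μ)
    (hZindep : iIndepFun Z μ) :
    GaussMarkov.IsRateFunction (GaussMarkov.rate P) ∧
    ∀ᵐ ω ∂μ, GaussMarkov.SatisfiesLDP
      (fun t => GaussMarkov.empMeasure π P (fun a => Z a ω) t) (GaussMarkov.rate P) := by
  have hV : Nonempty V := by
    by_contra h
    rw [not_nonempty_iff] at h
    have := hπ.sum_eq_one
    simp at this
  refine ⟨GaussMarkov.isRateFunction_rate hP hirr hπ, ?_⟩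
  obtain ⟨K, hK, htight⟩ := GaussMarkov.exists_isCompact_ae_eventually_hits_eq_zero hZmeas hZlaw
    hZindep hP (hπ.pos hirr)
  refine GaussMarkov.ae_satisfiesLDP_of_local hK ?_
    (GaussMarkov.exists_isOpen_ae_empMeasure_le hZmeas hZlaw hZindep hP hirr hπ)
    (GaussMarkov.ae_eventually_le_empMeasure hZmeas hZlaw hZindep hP hirr hπ)
  filter_upwards [htight] with ω hω
  filter_upwards [hω, eventually_gt_atTop 0] with t ht ht0
  rw [GaussMarkov.empMeasure_apply hK.measurableSet.compl
    (GaussMarkov.card_feasible_pos hP (hπ.pos hirr) ht0), ht]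
  simp
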